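/- Let $\mathcal G=(\mathcal V,\mathcal E,m)$ be a weighted graph: $\mathcal V$ is a countable set, $\mathcal E:\mathcal V\times\mathcal V\to[0,\infty)$ is symmetric, $m:\mathcal V\to(0,\infty)$, every vertex $x$ has only finitely many neighbors (vertices $y$ with $\mathcal E(x,y)>0$), and every connected component is infinite. On $\ell^2(\mathcal V,m)$ let $\Delta_{\mathcal G}$ be the Friedrichs extension of the operator $$f\mapsto \Big(x\mapsto \frac1{m(x)}\sum_{y\in\mathcal V}\mathcal E(x,y)\,(f(x)-f(y))\Big)$$ on finitely supported functions $f:\mathcal V\to\mathbb C$. Let $(S_n)_{n\ge 0}$ be a partition of $\mathcal V$ into finite nonempty sets such that $\mathcal E(x,y)>0$, $x\in S_n$, $y\in S_k$ imply $|n-k|\le 1$. For $x\in S_n$ put $|x|:=n$ and $$\deg_\pm(x):=\frac1{m(x)}\sum_{y\in S_{n\pm1}}\mathcal E(x,y),\qquad S_{-1}:=\emptyset .$$ Assume that $\mathcal G$ is weakly spherically symmetric with respect to $(S_n)_{n\ge0}$, that is, $\deg_+(x)$ and $\deg_-(x)$ depend only on $|x|$; write $\deg_\pm(n)$ for their common values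 on $S_n$. Let $\mathcal G_{\mathbb N}=(\mathbb N,\mathcal E_{\mathbb N},m_{\mathbb N})$ be the weighted graph on $\mathbb N=\{0,1,2,\dots\}$ with $$m_{\mathbb N}(n)=m(S_n):=\sum_{x\in S_n}m(x),\qquad \mathcal E_{\mathbb N}(n,n\pm1)=m(S_n)\deg_\pm(n),$$ and $\mathcal E_{\mathbb N}(n,k)=0$ for all other $k$, and let $\Delta_{\mathcal G_{\mathbb N}}$ be its Laplacian on $\ell^2(\mathbb N,m_{\mathbb N})$, defined in the same way. Assume that $m(\mathcal V)=\sum_{x\in\mathcal V}m(x)=+\infty$. Then $$\inf\sigma(\Delta_{\mathcal G})=\inf\sigma(\Delta_{\mathcal G_{\mathbb N}})\qquad\text{and}\qquad \inf\sigma_{\rm ess}(\Delta_{\mathcal G})=\inf\sigma_{\rm ess}(\Delta_{\mathcal G_{\mathbb N}}),$$ where $\sigma$ is the spectrum, $\sigma_{\rm ess}$ is the essential spectrum (the spectrum without the isolated eigenvalues of finite multiplicity), and $\inf\emptyset=+\infty$. -/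

import Mathlib

open MeasureTheory
open scoped ENNReal

noncomputable section

/-! ### Unbounded operators: spectrum and essential spectrum -/

namespace LinearPMap

variable {H : Type*} [NormedAddCommGroup H] [InnerProductSpace ℂ H]

/-- The resolvent set of an unbounded operator `A`: the `z` for which `A - z` is a bijection from
the domain of `A` onto the whole space with an everywhere defined bounded inverse `R`. -/
def resolventSet (A : H →ₗ.[ℂ] H) : Set ℂ :=
  {z | ∃ R : H →L[ℂ] H,
    (∀ u : A.domain, R (A u - z • (u : H)) = u) ∧
    ∀ v : H, ∃ u : A.domain, (u : H) = R v ∧ A u - z • (u : H) = v}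

/-- The spectrum `σ(A)` of an unbounded operator. -/
def spectrum (A : H →ₗ.[ℂ] H) : Set ℂ := A.resolventSetᶜ

/-- The eigenspace `{u ∈ D(A) : A u = z u}`. -/
def eigenspace (A : H →ₗ.[ℂ] H) (z : ℂ) : Submodule ℂ H :=
  (LinearMap.ker (A.toFun - z • A.domain.subtype)).map A.domain.subtype

/-- The discrete spectrum: eigenvalues of finite multiplicity that are isolated points of the
spectrum. -/
def discreteSpectrum (A : H →ₗ.[ℂ] H) : Set ℂ :=
  {z | z ∈ A.spectrum ∧ (∃ ε > 0, ∀ w ∈ A.spectrum, dist w z < ε → w = z) ∧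
    A.eigenspace z ≠ ⊥ ∧ FiniteDimensional ℂ (A.eigenspace z)}

/-- The essential spectrum `σ_ess(A)` (of a self-adjoint operator). -/
def essentialSpectrum (A : H →ₗ.[ℂ] H) : Set ℂ := A.spectrum \ A.discreteSpectrum

end LinearPMap

/-- The infimum of a subset of the complex plane that lies on the real line (such as the spectrum of
a self-adjoint operator), as an extended real number; the infimum of the empty set is `+∞`. -/
def spectralBottom (S : Set ℂ) : EReal := ⨅ z ∈ S, ((z.re : ℝ) : EReal)

/-! ### Weighted graphs -/

/-- A locally finite weighted graph `(V, E, m)`. -/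
structure WeightedGraph (V : Type*) where
  /-- The edge weight. -/
  E : V → V → ℝ
  /-- The vertex weight. -/
  m : V → ℝ
  E_nonneg : ∀ x y, 0 ≤ E x y
  E_symm : ∀ x y, E x y = E y x
  m_pos : ∀ x, 0 < m x
  locallyFinite : ∀ x, {y | 0 < E x y}.Finite

namespace WeightedGraph

section Basic

variable {V : Type*} (G : WeightedGraph V)

/-- The finite set of neighbours of `x`. -/
def neighbors (x : V) : Finset V := (G.locallyFinite x).toFinset

/-- The connected component of `x`: all vertices that can be reached from `x` along edges. -/
def component (x : V) : Set V := {y | Relation.ReflTransGen (fun a b => 0 < G.E a b) x y}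

/-- Every connected component of the graph is infinite. -/
def InfiniteComponents : Prop := ∀ x, (G.component x).Infinite

/-- The algebraic Laplacian `(1 / m x) ∑_y E(x,y) (f x - f y)`, on all functions. Only neighbours
of `x` contribute to the sum. -/
def algLaplacian (f : V → ℂ) (x : V) : ℂ :=
  (1 / (G.m x : ℂ)) * ∑ y ∈ G.neighbors x, (G.E x y : ℂ) * (f x - f y)

/-- The quadratic form `Q(f,f) = 1/2 ∑_x ∑_y E(x,y) |f x - f y|^2`, in `[0, ∞]`. -/
def energy (f : V → ℂ) : ℝ≥0∞ :=
  (1 / 2) * ∑' x, ∑' y, ENNReal.ofReal (G.E x y * ‖f x - f y‖ ^ 2)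

theorem mem_neighbors {x y : V} : y ∈ G.neighbors x ↔ 0 < G.E x y := by
  simp [neighbors]

theorem algLaplacian_add (f g : V → ℂ) :
    G.algLaplacian (f + g) = G.algLaplacian f + G.algLaplacian g := by
  funext x
  simp only [algLaplacian, Pi.add_apply, ← mul_add, ← Finset.sum_add_distrib]
  congr 1
  exact Finset.sum_congr rfl fun y _ => by ring

theorem algLaplacian_smul (c : ℂ) (f : V → ℂ) :
    G.algLaplacian (c • f) = c • G.algLaplacian f := by
  funext x
  simp only [algLaplacian, Pi.smul_apply, smul_eq_mul]
  rw [mul_left_comm, Finset.mul_sum _ _ c]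
  congr 1
  exact Finset.sum_congr rfl fun y _ => by ring

theorem support_algLaplacian_finite {f : V → ℂ} (hf : (Function.support f).Finite) :
    (Function.support (G.algLaplacian f)).Finite := by
  refine (hf.union (hf.biUnion fun y _ => G.locallyFinite y)).subset fun x hx => ?_
  by_contra hcon
  simp only [Set.mem_union, Set.mem_iUnion, Function.mem_support, Set.mem_ofPred_eq, not_or,
    not_exists, not_not] at hcon
  refine hx ?_
  rw [algLaplacian, Finset.sum_eq_zero, mul_zero]
  intro y hy
  have h1 : f y = 0 := by
    by_contra h
    exact hcon.2 y h (by rw [G.E_symm]; exact G.mem_neighbors.1 hy)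
  rw [hcon.1, h1, sub_zero, mul_zero]

theorem energy_zero : G.energy 0 = 0 := by simp [energy]

theorem energy_smul (c : ℂ) (f : V → ℂ) :
    G.energy (c • f) = ENNReal.ofReal (‖c‖ ^ 2) * G.energy f := by
  have h : ∀ x y, ENNReal.ofReal (G.E x y * ‖(c • f) x - (c • f) y‖ ^ 2) =
      ENNReal.ofReal (‖c‖ ^ 2) * ENNReal.ofReal (G.E x y * ‖f x - f y‖ ^ 2) := fun x y => by
    rw [← ENNReal.ofReal_mul (by positivity)]
    congr 1
    simp only [Pi.smul_apply, smul_eq_mul, ← mul_sub, norm_mul]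
    ring
  simp only [energy, h, ENNReal.tsum_mul_left]
  rw [mul_left_comm]

theorem energy_add_le (f g : V → ℂ) : G.energy (f + g) ≤ 2 * G.energy f + 2 * G.energy g := by
  have h : ∀ x y, ENNReal.ofReal (G.E x y * ‖(f + g) x - (f + g) y‖ ^ 2) ≤
      2 * ENNReal.ofReal (G.E x y * ‖f x - f y‖ ^ 2) +
      2 * ENNReal.ofReal (G.E x y * ‖g x - g y‖ ^ 2) := fun x y => by
    have hE := G.E_nonneg x y
    have h2 : (2 : ℝ≥0∞) = ENNReal.ofReal 2 := by simp
    rw [h2, ← ENNReal.ofReal_mul (by norm_num), ← ENNReal.ofReal_mul (by norm_num),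
      ← ENNReal.ofReal_add (by positivity) (by positivity)]
    apply ENNReal.ofReal_le_ofReal
    have h3 : ‖(f + g) x - (f + g) y‖ ≤ ‖f x - f y‖ + ‖g x - g y‖ := by
      rw [Pi.add_apply, Pi.add_apply, add_sub_add_comm]
      exact norm_add_le _ _
    have h4 : ‖(f + g) x - (f + g) y‖ ^ 2 ≤ 2 * ‖f x - f y‖ ^ 2 + 2 * ‖g x - g y‖ ^ 2 := by
      nlinarith [sq_nonneg (‖f x - f y‖ - ‖g x - g y‖), norm_nonneg ((f + g) x - (f + g) y)]
    nlinarith [mul_le_mul_of_nonneg_left h4 hE]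
  calc G.energy (f + g) ≤ (1 / 2) * ∑' x, ∑' y,
        (2 * ENNReal.ofReal (G.E x y * ‖f x - f y‖ ^ 2) +
          2 * ENNReal.ofReal (G.E x y * ‖g x - g y‖ ^ 2)) := by
        unfold energy
        gcongr with x y
        exact h x y
    _ = 2 * G.energy f + 2 * G.energy g := by
        simp only [energy, ENNReal.tsum_add, ENNReal.tsum_mul_left]
        ring

end Basic

/-! ### The Hilbert space `ℓ²(V, m)` and the Friedrichs Laplacian -/

section Laplacian

variable {V : Type*} [MeasurableSpace V] [DiscreteMeasurableSpace V] (G : WeightedGraph V)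

/-- The vertex weight as a measure on `V`: `m(A) = ∑_{x ∈ A} m x`. -/
def measure : Measure V :=
  Measure.sum fun x => ENNReal.ofReal (G.m x) • Measure.dirac x

/-- The complex Hilbert space `ℓ²(V, m)`, with inner product `∑_x conj (f x) (g x) m x`. -/
abbrev L2 : Type _ := Lp ℂ 2 G.measure

theorem measure_singleton (x : V) : G.measure {x} = ENNReal.ofReal (G.m x) := by
  classical
  rw [measure, Measure.sum_apply _ (MeasurableSet.of_discrete), tsum_eq_single x]
  · simp
  · intro y hy
    simp [hy]

/-- There are no null sets but the empty set: an element of `ℓ²(V, m)` is a genuine function. -/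
theorem ae_iff_forall {p : V → Prop} : (∀ᵐ x ∂G.measure, p x) ↔ ∀ x, p x := by
  refine ⟨fun h x => ?_, fun h => Filter.Eventually.of_forall h⟩
  by_contra hx
  have h1 : G.measure {x} ≤ G.measure {y | ¬ p y} :=
    measure_mono (Set.singleton_subset_iff.2 hx)
  rw [ae_iff.1 h, G.measure_singleton] at h1
  exact absurd (ENNReal.ofReal_eq_zero.1 (le_antisymm h1 (zero_le))) (not_le.2 (G.m_pos x))

theorem coeFn_add (f g : G.L2) : (⇑(f + g) : V → ℂ) = ⇑f + ⇑g :=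
  funext (G.ae_iff_forall.1 (Lp.coeFn_add f g))

theorem coeFn_sub (f g : G.L2) : (⇑(f - g) : V → ℂ) = ⇑f - ⇑g :=
  funext (G.ae_iff_forall.1 (Lp.coeFn_sub f g))

theorem coeFn_smul (c : ℂ) (f : G.L2) : (⇑(c • f) : V → ℂ) = c • ⇑f :=
  funext (G.ae_iff_forall.1 (Lp.coeFn_smul c f))

theorem coeFn_zero : (⇑(0 : G.L2) : V → ℂ) = 0 :=
  funext (G.ae_iff_forall.1 (Lp.coeFn_zero ℂ 2 G.measure))

theorem memLp_of_finite_support {f : V → ℂ} (hf : (Function.support f).Finite) :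
    MemLp f 2 G.measure := by
  classical
  have h : f = fun x => ∑ y ∈ hf.toFinset, Set.indicator {y} (fun _ => f y) x := by
    funext x
    by_cases hx : f x = 0
    · rw [hx, Finset.sum_eq_zero]
      intro y hy
      by_cases hxy : x = y
      · subst hxy
        simp [hx]
      · simp [hxy]
    · rw [Finset.sum_eq_single x]
      · simp
      · intro y _ hy
        simp [hy.symm]
      · intro hx'
        simp at hx'
        exact absurd hx' hx
  rw [h]
  refine memLp_finsetSum _ fun y _ => ?_
  refine memLp_indicator_const 2 MeasurableSet.of_discrete _ (Or.inr ?_)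
  rw [G.measure_singleton]
  exact ENNReal.ofReal_ne_top

/-- The finitely supported functions `C_c(V)`, as a subspace of `ℓ²(V, m)`. -/
def finSupp : Submodule ℂ G.L2 where
  carrier := {f | (Function.support (⇑f : V → ℂ)).Finite}
  add_mem' {f g} hf hg := by
    rw [Set.mem_ofPred_eq, G.coeFn_add]
    exact (hf.union hg).subset (Function.support_add _ _)
  zero_mem' := by
    rw [Set.mem_ofPred_eq, G.coeFn_zero]
    simp
  smul_mem' c f hf := by
    rw [Set.mem_ofPred_eq, G.coeFn_smul]
    exact hf.subset (Function.support_const_smul_subset c _)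

/-- The Laplacian on finitely supported functions. -/
def minLaplacian : G.L2 →ₗ.[ℂ] G.L2 where
  domain := G.finSupp
  toFun :=
    { toFun := fun f => MemLp.toLp (G.algLaplacian ⇑(f : G.L2))
        (G.memLp_of_finite_support (G.support_algLaplacian_finite f.2))
      map_add' := fun f g => by
        rw [← MemLp.toLp_add]
        refine MemLp.toLp_congr _ _ (G.ae_iff_forall.2 fun x => ?_)
        rw [Submodule.coe_add, G.coeFn_add, G.algLaplacian_add]
      map_smul' := fun c f => by
        rw [RingHom.id_apply, ← MemLp.toLp_const_smul]
        refine MemLp.toLp_congr _ _ (G.ae_iff_forall.2 fun x => ?_)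
        rw [Submodule.coe_smul, G.coeFn_smul, G.algLaplacian_smul] }

/-- The form domain: the closure of `C_c(V)` in `ℓ²(V, m)` for the form norm
`(‖f‖² + Q(f,f))^(1/2)`. -/
def formDomain : Submodule ℂ G.L2 where
  carrier := {f | ∃ φ : ℕ → G.L2, (∀ n, φ n ∈ G.finSupp) ∧
    Filter.Tendsto (fun n => ‖f - φ n‖) Filter.atTop (nhds 0) ∧
    Filter.Tendsto (fun n => G.energy ⇑(f - φ n)) Filter.atTop (nhds 0)}
  add_mem' {f g} := by
    rintro ⟨φ, h1, h2, h3⟩ ⟨ψ, k1, k2, k3⟩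
    refine ⟨fun n => φ n + ψ n, fun n => add_mem (h1 n) (k1 n), ?_, ?_⟩
    · refine squeeze_zero (fun _ => norm_nonneg _) (fun n => ?_) (by simpa using h2.add k2)
      rw [add_sub_add_comm]
      exact norm_add_le _ _
    · have h4 : Filter.Tendsto
          (fun n => 2 * G.energy ⇑(f - φ n) + 2 * G.energy ⇑(g - ψ n))
          Filter.atTop (nhds 0) := by
        have a := ENNReal.Tendsto.const_mul (a := 2) h3 (Or.inr (by simp))
        have b := ENNReal.Tendsto.const_mul (a := 2) k3 (Or.inr (by simp))
        simpa using a.add b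
      refine tendsto_of_tendsto_of_tendsto_of_le_of_le tendsto_const_nhds h4
        (fun _ => zero_le) fun n => ?_
      show G.energy ⇑(f + g - (φ n + ψ n)) ≤ _
      rw [add_sub_add_comm, G.coeFn_add]
      exact G.energy_add_le _ _
  zero_mem' := ⟨fun _ => 0, fun _ => zero_mem _, by simp, by
    simp only [sub_zero, G.coeFn_zero, G.energy_zero]
    exact tendsto_const_nhds⟩
  smul_mem' c f := by
    rintro ⟨φ, h1, h2, h3⟩
    refine ⟨fun n => c • φ n, fun n => Submodule.smul_mem _ _ (h1 n), ?_, ?_⟩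
    · simp only [← smul_sub, norm_smul]
      simpa using h2.const_mul ‖c‖
    · simp only [← smul_sub, G.coeFn_smul c, G.energy_smul]
      have h4 := ENNReal.Tendsto.const_mul (a := ENNReal.ofReal (‖c‖ ^ 2)) h3
        (Or.inr ENNReal.ofReal_ne_top)
      rwa [mul_zero] at h4

/-- The Laplacian `Δ_G`: the Friedrichs extension of the Laplacian on finitely supported functions,
i.e. the restriction of the adjoint of the latter to the form domain. -/
def laplacian : G.L2 →ₗ.[ℂ] G.L2 := G.minLaplacian.adjoint.domRestrict G.formDomain

end Laplacian

/-! ### One-dimensional decompositions and weakly spherically symmetric graphs -/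

section Radial

variable {V : Type*}

/-- A 1-dimensional decomposition: a partition of the vertices into finite nonempty sets `S_n`,
`n ≥ 0`, with edges only inside the `S_n` and between consecutive ones. -/
structure OneDimDecomposition (G : WeightedGraph V) where
  /-- The sets `S_n`. -/
  S : ℕ → Finset V
  nonempty : ∀ n, (S n).Nonempty
  partition : ∀ x, ∃! n, x ∈ S n
  adj : ∀ n k, ∀ x ∈ S n, ∀ y ∈ S k, 0 < G.E x y → |(n : ℤ) - (k : ℤ)| ≤ 1

namespace OneDimDecomposition

variable {G : WeightedGraph V} (D : OneDimDecomposition G)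

/-- `|x|`, the index `n` with `x ∈ S_n`. -/
def radius (x : V) : ℕ := (D.partition x).choose

/-- `S_{n-1}`, with `S_{-1} = ∅`. -/
def prev : ℕ → Finset V
  | 0 => ∅
  | n + 1 => D.S n

/-- `deg_+(x) = (1 / m x) ∑_{y ∈ S_{|x|+1}} E(x,y)`. -/
def degPlus (x : V) : ℝ := (∑ y ∈ D.S (D.radius x + 1), G.E x y) / G.m x

/-- `deg_-(x) = (1 / m x) ∑_{y ∈ S_{|x|-1}} E(x,y)`. -/
def degMinus (x : V) : ℝ := (∑ y ∈ D.prev (D.radius x), G.E x y) / G.m x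

/-- The graph is weakly spherically symmetric with respect to the decomposition: `deg_+(x)` and
`deg_-(x)` depend only on `|x|`. -/
def WeaklySphericallySymmetric : Prop :=
  ∀ x y, D.radius x = D.radius y → D.degPlus x = D.degPlus y ∧ D.degMinus x = D.degMinus y

/-- `m(S_n)`. -/
def sphereMass (n : ℕ) : ℝ := ∑ x ∈ D.S n, G.m x

/-- A vertex of `S_n`. -/
def point (n : ℕ) : V := (D.nonempty n).choose

/-- `deg_+(n)`, the value of `deg_+` at a point of `S_n`. -/
def radialDegPlus (n : ℕ) : ℝ := D.degPlus (D.point n)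

/-- `deg_-(n)`, the value of `deg_-` at a point of `S_n`. -/
def radialDegMinus (n : ℕ) : ℝ := D.degMinus (D.point n)

theorem mem_S_radius (x : V) : x ∈ D.S (D.radius x) := (D.partition x).choose_spec.1

theorem radius_eq {x : V} {n : ℕ} (h : x ∈ D.S n) : D.radius x = n :=
  ((D.partition x).choose_spec.2 n h).symm

theorem radius_point (n : ℕ) : D.radius (D.point n) = n :=
  D.radius_eq (D.nonempty n).choose_spec

theorem degPlus_nonneg (x : V) : 0 ≤ D.degPlus x :=
  div_nonneg (Finset.sum_nonneg fun _ _ => G.E_nonneg _ _) (G.m_pos x).le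

theorem degMinus_nonneg (x : V) : 0 ≤ D.degMinus x :=
  div_nonneg (Finset.sum_nonneg fun _ _ => G.E_nonneg _ _) (G.m_pos x).le

theorem sphereMass_pos (n : ℕ) : 0 < D.sphereMass n :=
  Finset.sum_pos (fun x _ => G.m_pos x) (D.nonempty n)

theorem sphereMass_mul_radialDegPlus (h : D.WeaklySphericallySymmetric) (n : ℕ) :
    D.sphereMass n * D.radialDegPlus n = D.sphereMass (n + 1) * D.radialDegMinus (n + 1) := by
  have h1 : D.sphereMass n * D.radialDegPlus n = ∑ x ∈ D.S n, ∑ y ∈ D.S (n + 1), G.E x y := by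
    rw [sphereMass, Finset.sum_mul]
    refine Finset.sum_congr rfl fun x hx => ?_
    have hr := D.radius_eq hx
    rw [radialDegPlus, (h (D.point n) x (by rw [D.radius_point, hr])).1, degPlus, hr,
      mul_div_cancel₀ _ (G.m_pos x).ne']
  have h2 : D.sphereMass (n + 1) * D.radialDegMinus (n + 1) =
      ∑ y ∈ D.S (n + 1), ∑ x ∈ D.S n, G.E y x := by
    rw [sphereMass, Finset.sum_mul]
    refine Finset.sum_congr rfl fun y hy => ?_
    have hr := D.radius_eq hy
    rw [radialDegMinus, (h (D.point (n + 1)) y (by rw [D.radius_point, hr])).2, degMinus, hr,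
      mul_div_cancel₀ _ (G.m_pos y).ne']
    rfl
  rw [h1, h2, Finset.sum_comm]
  exact Finset.sum_congr rfl fun y _ => Finset.sum_congr rfl fun x _ => G.E_symm x y

/-- `E_ℕ(n, n ± 1) = m(S_n) deg_±(n)`, and `E_ℕ(n, k) = 0` for all other `k`. -/
def radialE (n k : ℕ) : ℝ :=
  if k = n + 1 then D.sphereMass n * D.radialDegPlus n
  else if k + 1 = n then D.sphereMass n * D.radialDegMinus n
  else 0

/-- The radial graph `G_ℕ = (ℕ, E_ℕ, m_ℕ)` with `m_ℕ(n) = m(S_n)`. -/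
def radialGraph (h : D.WeaklySphericallySymmetric) : WeightedGraph ℕ where
  E := D.radialE
  m := D.sphereMass
  E_nonneg n k := by
    unfold radialE
    split_ifs
    · exact mul_nonneg (D.sphereMass_pos n).le (D.degPlus_nonneg _)
    · exact mul_nonneg (D.sphereMass_pos n).le (D.degMinus_nonneg _)
    · exact le_rfl
  E_symm n k := by
    unfold radialE
    by_cases h1 : k = n + 1
    · subst h1
      rw [if_pos rfl, if_neg (by omega), if_pos rfl]
      exact D.sphereMass_mul_radialDegPlus h n
    · by_cases h2 : k + 1 = n
      · subst h2
        rw [if_neg (by omega), if_pos rfl, if_pos rfl]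
        exact (D.sphereMass_mul_radialDegPlus h k).symm
      · rw [if_neg h1, if_neg h2, if_neg (fun h3 => h2 h3.symm), if_neg (fun h3 => h1 h3.symm)]
  m_pos := D.sphereMass_pos
  locallyFinite n := by
    refine (Set.finite_Iic (n + 1)).subset fun k hk => ?_
    simp only [Set.mem_ofPred_eq, radialE] at hk
    rw [Set.mem_Iic]
    by_contra hcon
    rw [if_neg (by omega), if_neg (by omega)] at hk
    exact lt_irrefl _ hk

end OneDimDecomposition

end Radial

end WeightedGraph

end

/-! Both spectral bottoms are governed by lower bounds of the quadratic form on finitely supported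
functions. For a nonnegative self-adjoint operator with a form core, the bottom of the spectrum is
the infimum of the form on unit vectors of the core
(`LinearPMap.IsNonnegSelfAdjoint.coe_lt_spectralBottom_spectrum_iff`). By Persson's theorem, the
bottom of the essential spectrum is the limit of these infima over core vectors orthogonal to an
increasing sequence of finite-dimensional spaces exhausting the core
(`LinearPMap.IsNonnegSelfAdjoint.coe_lt_spectralBottom_essentialSpectrum_iff`). For graph Laplacians
these spaces consist of the functions supported in finite balls, and orthogonality means vanishing
on the ball. It therefore suffices to compare, for each n, the form on functions vanishing on the
first n spheres of the graph with the form on functions on ℕ vanishing on {0, …, n - 1}; the case n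
= 0 gives the spectrum itself.

One direction is restriction to radial functions: composition with the radius preserves norms and
intertwines the two Laplacians, so a bound on the graph passes to ℕ.

The converse must also control non-radial functions, and uses positive solutions in the spirit of
Allegretto and Piepenbrink. If the form on ℕ is at least ν off {0, …, n - 1} and μ < ν, the
recursion for Δu = μu started with u(n) = 1 and zero before n stays positive
(`WeightedGraph.HasLowerBoundOff.exists_positive_solution`). Its lift to the graph solves the same
equation outside the ball, and writing f = u h shows that the form is at least μ there
(`WeightedGraph.lowerBound_of_supersolution`). The loss from ν to μ is harmless because only strict
inequalities against real numbers l are compared.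

The operator theory needs self-adjointness of the Friedrichs extension and the fact that finitely
supported functions form a core (`LinearPMap.isNonnegSelfAdjoint_domRestrict_adjoint`); both come
from a variational solution of (T + 1)u = v. -/

noncomputable section

/-! ### Nonnegative self-adjoint operators -/

namespace LinearPMap

open Filter Topology

variable {H : Type*} [NormedAddCommGroup H] [InnerProductSpace ℂ H]

/-- A nonnegative symmetric operator `A` for which `A + 1` is onto, i.e. a nonnegative self-adjoint
operator. -/
structure IsNonnegSelfAdjoint (A : H →ₗ.[ℂ] H) : Prop where
  symm : ∀ u w : A.domain, inner ℂ (A u) (w : H) = inner ℂ (u : H) (A w)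
  nonneg : ∀ u : A.domain, 0 ≤ (inner ℂ (A u) (u : H)).re
  surj : ∀ v, ∃ u : A.domain, A u + (u : H) = v

/-- A subspace `C` of the domain of `A` that is dense with respect to the quadratic form of `A`. -/
structure IsFormCore (A : H →ₗ.[ℂ] H) (C : Submodule ℂ H) : Prop where
  le : C ≤ A.domain
  approx : ∀ u : A.domain, ∃ φ : ℕ → A.domain, (∀ n, (φ n : H) ∈ C) ∧
    Tendsto (fun n => (φ n : H)) atTop (𝓝 u) ∧
    Tendsto (fun n => (inner ℂ (A (φ n)) (φ n : H)).re) atTop (𝓝 (inner ℂ (A u) (u : H)).re)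

variable {A : H →ₗ.[ℂ] H}

theorem inner_self_eq_ofReal (x : H) : inner ℂ x x = ((‖x‖ ^ 2 : ℝ) : ℂ) := by
  rw [inner_self_eq_norm_sq_to_K]
  norm_cast

theorem mem_eigenspace {z : ℂ} {x : H} :
    x ∈ A.eigenspace z ↔ ∃ u : A.domain, (u : H) = x ∧ A u = z • (u : H) := by
  simp only [eigenspace, Submodule.mem_map, LinearMap.mem_ker, LinearMap.sub_apply,
    LinearMap.smul_apply, Submodule.subtype_apply, sub_eq_zero, toFun_eq_coe]
  exact ⟨fun ⟨u, h1, h2⟩ => ⟨u, h2, h1⟩, fun ⟨u, h1, h2⟩ => ⟨u, h2, h1⟩⟩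

/-- A bijection onto the whole space that is bounded below has a bounded inverse. -/
theorem mem_resolventSet_of_bound {z : ℂ} {c : ℝ} (hc : 0 < c)
    (hb : ∀ u : A.domain, c * ‖(u : H)‖ ≤ ‖A u - z • (u : H)‖)
    (hs : ∀ v, ∃ u : A.domain, A u - z • (u : H) = v) : z ∈ A.resolventSet := by
  let T : A.domain →ₗ[ℂ] H := A.toFun - z • A.domain.subtype
  have hT : ∀ u, T u = A u - z • (u : H) := fun u => rfl
  have hinj : Function.Injective T := by
    rw [injective_iff_map_eq_zero]
    intro u hu
    have := hb u
    rw [← hT, hu, norm_zero] at this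
    have h0 : ‖(u : H)‖ = 0 := le_antisymm (by nlinarith) (norm_nonneg _)
    simpa using h0
  let e := LinearEquiv.ofBijective T ⟨hinj, hs⟩
  let R : H →L[ℂ] H := LinearMap.mkContinuous (A.domain.subtype ∘ₗ (e.symm : H →ₗ[ℂ] A.domain)) c⁻¹
    (fun v => by
      have h1 := hb (e.symm v)
      rw [← hT, show T (e.symm v) = v from e.apply_symm_apply v] at h1
      rw [inv_mul_eq_div, le_div_iff₀ hc, mul_comm]
      exact h1)
  refine ⟨R, fun u => ?_, fun v => ⟨e.symm v, rfl, e.apply_symm_apply v⟩⟩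
  show ((e.symm (e u) : A.domain) : H) = u
  rw [e.symm_apply_apply]

namespace IsNonnegSelfAdjoint

theorem norm_le_norm_add (hA : A.IsNonnegSelfAdjoint) (u : A.domain) :
    ‖(u : H)‖ ≤ ‖A u + (u : H)‖ := by
  have h1 := hA.nonneg u
  have h2 : ‖(u : H)‖ ^ 2 ≤ (inner ℂ (A u + (u : H)) (u : H)).re := by
    rw [inner_add_left, Complex.add_re]
    have := inner_self_eq_norm_sq (𝕜 := ℂ) (u : H)
    simp only [RCLike.re_to_complex] at this
    linarith
  have h3 : (inner ℂ (A u + (u : H)) (u : H)).re ≤ ‖A u + (u : H)‖ * ‖(u : H)‖ :=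
    (Complex.re_le_norm _).trans (norm_inner_le_norm _ _)
  by_contra! h
  nlinarith [norm_nonneg (u : H), norm_nonneg (A u + (u : H))]

theorem neg_one_mem_resolventSet (hA : A.IsNonnegSelfAdjoint) : -1 ∈ A.resolventSet := by
  refine mem_resolventSet_of_bound one_pos (fun u => ?_) fun v => ?_
  · simpa using hA.norm_le_norm_add u
  · simpa using hA.surj v

/-- Existence and symmetry of the bounded operator `(A + 1)⁻¹`. -/
theorem exists_resolvent (hA : A.IsNonnegSelfAdjoint) : ∃ R : H →L[ℂ] H,
    (∀ u : A.domain, R (A u + (u : H)) = u) ∧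
    (∀ v : H, ∃ u : A.domain, (u : H) = R v ∧ A u + (u : H) = v) ∧
    ∀ v w, inner ℂ (R v) w = inner ℂ v (R w) := by
  obtain ⟨R, h1, h2⟩ := hA.neg_one_mem_resolventSet
  simp only [neg_smul, one_smul, sub_neg_eq_add] at h1 h2
  refine ⟨R, h1, h2, fun v w => ?_⟩
  obtain ⟨u, hu, rfl⟩ := h2 v
  obtain ⟨x, hx, rfl⟩ := h2 w
  rw [h1, h1, inner_add_left, inner_add_right, hA.symm]

theorem im_inner (hA : A.IsNonnegSelfAdjoint) (u : A.domain) :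
    (inner ℂ (A u) (u : H)).im = 0 := by
  have h := hA.symm u u
  rw [← inner_conj_symm (u : H) (A u)] at h
  exact Complex.conj_eq_iff_im.1 h.symm

/-- A self-adjoint operator is closed; stated for approximate eigenvectors. -/
theorem exists_eigenvector_of_tendsto (hA : A.IsNonnegSelfAdjoint) {z : ℂ}
    {w : ℕ → A.domain} {x : H} (h1 : Tendsto (fun n => (w n : H)) atTop (𝓝 x))
    (h2 : Tendsto (fun n => A (w n) - z • (w n : H)) atTop (𝓝 0)) : x ∈ A.eigenspace z := by
  obtain ⟨R, hR1, hR2, -⟩ := hA.exists_resolvent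
  have h3 : Tendsto (fun n => R ((A (w n) - z • (w n : H)) + (z + 1) • (w n : H))) atTop
      (𝓝 (R (0 + (z + 1) • x))) :=
    (R.continuous.tendsto _).comp (h2.add (h1.const_smul _))
  have h4 : ∀ n, R ((A (w n) - z • (w n : H)) + (z + 1) • (w n : H)) = w n := fun n => by
    rw [add_smul, one_smul, ← add_assoc, sub_add_cancel, hR1]
  simp only [h4, zero_add] at h3
  have h5 := tendsto_nhds_unique h1 h3
  obtain ⟨u, hu1, hu2⟩ := hR2 ((z + 1) • x)
  refine mem_eigenspace.2 ⟨u, hu1.trans h5.symm, ?_⟩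
  rw [← h5] at hu1
  rw [← hu1, add_smul, one_smul] at hu2
  exact add_right_cancel hu2

/-- With R = (A + 1)⁻¹, the bounded operator B = 1 - (z + 1)R equals (A - z)R. The lower bound for A
- z makes B bounded below, so its range is closed. A vector y orthogonal to that range satisfies y =
conj(z + 1) R y, hence lies in the domain with A y = conj(z) y, and so vanishes. Thus A - z is onto.
-/
theorem mem_resolventSet_of_bound [CompleteSpace H] (hA : A.IsNonnegSelfAdjoint) {z : ℂ} {c : ℝ}
    (hc : 0 < c) (hb : ∀ u : A.domain, c * ‖(u : H)‖ ≤ ‖A u - z • (u : H)‖)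
    (hb' : ∀ u : A.domain, A u = (starRingEnd ℂ) z • (u : H) → u = 0) :
    z ∈ A.resolventSet := by
  refine LinearPMap.mem_resolventSet_of_bound hc hb fun v => ?_
  obtain ⟨R, hR1, hR2, hR3⟩ := hA.exists_resolvent
  let B : H →L[ℂ] H := ContinuousLinearMap.id ℂ H - (z + 1) • R
  have hB : ∀ x, B x = x - (z + 1) • R x := fun x => rfl
  have hBA : ∀ x, ∃ u : A.domain, (u : H) = R x ∧ A u + (u : H) = x ∧ B x = A u - z • (u : H) := by
    intro x
    obtain ⟨u, hu1, hu2⟩ := hR2 x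
    refine ⟨u, hu1, hu2, ?_⟩
    rw [hB, ← hu1, ← hu2, add_smul, one_smul]
    abel
  have hbd : ∀ x, ‖x‖ ≤ (1 + ‖z + 1‖ / c) * ‖B x‖ := by
    intro x
    obtain ⟨u, hu1, hu2, hu3⟩ := hBA x
    have h1 := hb u
    rw [← hu3] at h1
    have h2 : x = B x + (z + 1) • (u : H) := by rw [hB, hu1]; abel
    calc ‖x‖ = ‖B x + (z + 1) • (u : H)‖ := by rw [← h2]
      _ ≤ ‖B x‖ + ‖z + 1‖ * ‖(u : H)‖ := (norm_add_le _ _).trans (by rw [norm_smul])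
      _ ≤ ‖B x‖ + ‖z + 1‖ * (‖B x‖ / c) := by
        gcongr
        rw [le_div_iff₀ hc, mul_comm]
        exact h1
      _ = _ := by ring
  have hanti : AntilipschitzWith (Real.toNNReal (1 + ‖z + 1‖ / c)) B :=
    B.antilipschitz_of_bound fun x => by
      rw [Real.coe_toNNReal _ (by positivity)]
      exact hbd x
  have hcl : _root_.IsClosed (B.range : Set H) := by
    have h := hanti.isClosed_range B.uniformContinuous
    rwa [LinearMap.coe_range]
  have htop : B.range = ⊤ := by
    have : CompleteSpace B.range := hcl.completeSpace_coe
    rw [← Submodule.orthogonal_eq_bot_iff, Submodule.eq_bot_iff]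
    intro y hy
    have h1 : ∀ x, inner ℂ x (y - (starRingEnd ℂ) (z + 1) • R y) = 0 := by
      intro x
      have h2 := (Submodule.mem_orthogonal _ _).1 hy (B x) ⟨x, rfl⟩
      rw [hB, inner_sub_left, inner_smul_left, hR3] at h2
      rw [inner_sub_right, inner_smul_right]
      exact h2
    have h3 := inner_self_eq_zero.1 (h1 _)
    obtain ⟨u, hu1, hu2⟩ := hR2 y
    rw [← hu1, sub_eq_zero] at h3
    have h4 := hb' u (by
      have h5 : A u + (u : H) = (starRingEnd ℂ) z • (u : H) + (u : H) := by
        rw [hu2, h3, RingHom.map_add, RingHom.map_one, add_smul, one_smul]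
      exact add_right_cancel h5)
    rw [h3, h4]
    simp
  have : v ∈ B.range := htop ▸ Submodule.mem_top
  obtain ⟨x, hx⟩ := this
  obtain ⟨u, -, -, hu⟩ := hBA x
  exact ⟨u, hu.symm.trans hx⟩

theorem re_inner_sub (z : ℂ) (u : A.domain) :
    (inner ℂ (A u - z • (u : H)) (u : H)).re =
      (inner ℂ (A u) (u : H)).re - z.re * ‖(u : H)‖ ^ 2 := by
  rw [inner_sub_left, inner_smul_left, inner_self_eq_ofReal, Complex.sub_re, Complex.re_mul_ofReal,
    Complex.conj_re]

/-- The imaginary part of ⟨(A - y)u, u⟩ is Im y · ‖u‖², which bounds A - y from below when Im y ≠ 0;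
this is used for both z and its conjugate. -/
theorem mem_spectrum_real [CompleteSpace H] (hA : A.IsNonnegSelfAdjoint) {z : ℂ}
    (hz : z ∈ A.spectrum) : z.im = 0 := by
  by_contra him
  have key : ∀ y : ℂ, y.im ≠ 0 → ∀ u : A.domain, |y.im| * ‖(u : H)‖ ≤ ‖A u - y • (u : H)‖ := by
    intro y _ u
    have h1 : (inner ℂ (A u - y • (u : H)) (u : H)).im = y.im * ‖(u : H)‖ ^ 2 := by
      rw [inner_sub_left, inner_smul_left, inner_self_eq_ofReal, Complex.sub_im, hA.im_inner,
        Complex.im_mul_ofReal, Complex.conj_im, zero_sub, neg_mul, neg_neg]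
    have h2 := (Complex.abs_im_le_norm _).trans
      (norm_inner_le_norm (𝕜 := ℂ) (A u - y • (u : H)) (u : H))
    rw [h1, abs_mul, abs_of_nonneg (sq_nonneg ‖(u : H)‖)] at h2
    by_contra! h
    have h3 : 0 < ‖(u : H)‖ := by
      by_contra! h3
      rw [le_antisymm h3 (norm_nonneg _), mul_zero] at h
      exact absurd h (not_lt.2 (norm_nonneg _))
    nlinarith
  refine hz (hA.mem_resolventSet_of_bound (abs_pos.2 him) (key z him) fun u hu => ?_)
  have h3 := key ((starRingEnd ℂ) z) (by simpa using him) u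
  rw [hu, sub_self, norm_zero, Complex.conj_im, abs_neg] at h3
  have h4 : ‖(u : H)‖ = 0 := le_antisymm (by nlinarith [abs_pos.2 him]) (norm_nonneg _)
  simpa using h4

/-- Weyl's criterion: points of the spectrum have approximate eigenvectors. -/
theorem exists_approx_eigenvector [CompleteSpace H] (hA : A.IsNonnegSelfAdjoint) {z : ℂ}
    (hz : z ∈ A.spectrum) {ε : ℝ} (hε : 0 < ε) :
    ∃ u : A.domain, ‖(u : H)‖ = 1 ∧ ‖A u - z • (u : H)‖ < ε := by
  by_contra! hcon
  have hb : ∀ u : A.domain, ε * ‖(u : H)‖ ≤ ‖A u - z • (u : H)‖ := by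
    intro u
    by_cases hu : (u : H) = 0
    · simp [hu]
    · have hn : 0 < ‖(u : H)‖ := norm_pos_iff.2 hu
      have h1 := hcon (((‖(u : H)‖⁻¹ : ℝ) : ℂ) • u) (by
        rw [Submodule.coe_smul, norm_smul, Complex.norm_real, norm_inv, norm_norm,
          inv_mul_cancel₀ hn.ne'])
      rw [map_smul, Submodule.coe_smul, smul_comm z, ← smul_sub, norm_smul, Complex.norm_real,
        norm_inv, norm_norm, inv_mul_eq_div, le_div_iff₀ hn] at h1
      exact h1
  refine hz (hA.mem_resolventSet_of_bound hε hb fun u hu => ?_)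
  rw [Complex.conj_eq_iff_im.2 (hA.mem_spectrum_real hz)] at hu
  have h3 := hb u
  rw [hu, sub_self, norm_zero] at h3
  have h4 : ‖(u : H)‖ = 0 := le_antisymm (by nlinarith) (norm_nonneg _)
  simpa using h4

theorem le_re_of_mem_spectrum [CompleteSpace H] (hA : A.IsNonnegSelfAdjoint) {μ : ℝ}
    (hμ : ∀ u : A.domain, μ * ‖(u : H)‖ ^ 2 ≤ (inner ℂ (A u) (u : H)).re) {z : ℂ}
    (hz : z ∈ A.spectrum) : μ ≤ z.re := by
  refine le_of_forall_pos_lt_add fun ε hε => ?_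
  obtain ⟨u, hu1, hu2⟩ := hA.exists_approx_eigenvector hz hε
  have h1 := (Complex.re_le_norm _).trans
    (norm_inner_le_norm (𝕜 := ℂ) (A u - z • (u : H)) (u : H))
  rw [re_inner_sub, hu1] at h1
  have h2 := hμ u
  rw [hu1] at h2
  linarith

end IsNonnegSelfAdjoint

end LinearPMap

/-! ### Isolated spectral points and the reduced resolvent -/

theorem continuousOn_of_isolated {K : Set ℂ} {t : ℂ} {f : ℂ → ℂ}
    (ht : ∀ᶠ s in nhdsWithin t K, s = t) (hf : ∀ s, s ≠ t → ContinuousAt f s) :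
    ContinuousOn f K := by
  intro s _
  by_cases hst : s = t
  · subst hst
    refine (continuousWithinAt_const (b := f s)).congr_of_eventuallyEq ?_ rfl
    filter_upwards [ht] with x hx
    rw [hx]
  · exact (hf s hst).continuousWithinAt

namespace LinearPMap

open Filter Topology

variable {H : Type*} [NormedAddCommGroup H] [InnerProductSpace ℂ H] {A : H →ₗ.[ℂ] H}

namespace IsNonnegSelfAdjoint

/-- Spectral mapping for the resolvent `R = (A + 1)⁻¹`. -/
theorem inv_sub_one_mem_spectrum {R : H →L[ℂ] H}
    (hR1 : ∀ u : A.domain, R (A u + (u : H)) = u)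
    (hR2 : ∀ v : H, ∃ u : A.domain, (u : H) = R v ∧ A u + (u : H) = v)
    {s : ℂ} (hs : s ∈ _root_.spectrum ℂ R) (hs0 : s ≠ 0) : s⁻¹ - 1 ∈ A.spectrum := by
  rintro ⟨T, hT1, hT2⟩
  have hT1' : ∀ u : A.domain, T (A u + (u : H)) = u + s⁻¹ • T u := fun u => by
    have h : A u + (u : H) = (A u - (s⁻¹ - 1) • (u : H)) + s⁻¹ • (u : H) := by
      rw [sub_smul, one_smul]
      abel
    rw [h, _root_.map_add, hT1, _root_.map_smul]
  have hR1' : ∀ u : A.domain, R (A u - (s⁻¹ - 1) • (u : H)) = u - s⁻¹ • R u := fun u => by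
    have h : A u - (s⁻¹ - 1) • (u : H) = (A u + (u : H)) - s⁻¹ • (u : H) := by
      rw [sub_smul, one_smul]
      abel
    rw [h, _root_.map_sub, hR1, _root_.map_smul]
  refine hs (isUnit_iff_exists.2 ⟨s⁻¹ • (1 + s⁻¹ • T), ?_, ?_⟩)
  · ext v
    obtain ⟨u, hu1, hu2⟩ := hT2 v
    have h := hR1' u
    rw [hu2] at h
    simp only [mul_apply_eq_comp, _root_.sub_apply,
      Algebra.algebraMap_eq_smul_one, _root_.smul_apply,
      one_apply_eq_self, _root_.add_apply, _root_.map_smul, _root_.map_add, ← hu1, h,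
      smul_add, smul_sub, smul_smul]
    match_scalars <;> field_simp <;> ring
  · ext v
    obtain ⟨u, hu1, hu2⟩ := hR2 v
    have h := hT1' u
    rw [hu2] at h
    simp only [mul_apply_eq_comp, _root_.sub_apply,
      Algebra.algebraMap_eq_smul_one, _root_.smul_apply,
      one_apply_eq_self, _root_.add_apply, _root_.map_smul, _root_.map_sub, ← hu1, h,
      smul_add, smul_smul]
    match_scalars <;> field_simp <;> ring

/-- At an isolated point `z` of the spectrum there is a reduced resolvent: a bounded operator that
inverts `A - z` up to an operator with values in the eigenspace. -/
theorem exists_reduced_resolvent [CompleteSpace H] (hA : A.IsNonnegSelfAdjoint) {z : ℂ} {ε : ℝ}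
    (hz1 : z ≠ -1) (hε : 0 < ε) (hz : ∀ w ∈ A.spectrum, dist w z < ε → w = z) :
    ∃ S E : H →L[ℂ] H, (∀ v, ∃ u : A.domain, (u : H) = S v ∧ A u - z • (u : H) = v - E v) ∧
      ∀ v, E v ∈ A.eigenspace z := by
  obtain ⟨R, hR1, hR2, hR3⟩ := hA.exists_resolvent
  have hRs : IsStarNormal R := by
    have : IsSelfAdjoint R := by
      rw [ContinuousLinearMap.isSelfAdjoint_iff_isSymmetric]
      exact hR3
    exact this.isStarNormal
  have hz1' : z + 1 ≠ 0 := fun h => hz1 (eq_neg_of_add_eq_zero_left h)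
  -- The point corresponding to z under the spectral mapping s ↦ s⁻¹ - 1; it is isolated in the
  -- spectrum of R.
  obtain ⟨t, ht⟩ : ∃ t : ℂ, t = (z + 1)⁻¹ := ⟨_, rfl⟩
  have ht0 : t ≠ 0 := ht ▸ inv_ne_zero hz1'
  have htz : t⁻¹ - 1 = z := by rw [ht, inv_inv]; ring
  have hiso : ∀ᶠ s in 𝓝[_root_.spectrum ℂ R] t, s = t := by
    have hc : ContinuousAt (fun s : ℂ => s⁻¹ - 1) t := (continuousAt_inv₀ ht0).sub_const 1
    have h1 : ∀ᶠ s in 𝓝[_root_.spectrum ℂ R] t, dist (s⁻¹ - 1) z < ε := by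
      have := hc.tendsto
      simp only [htz] at this
      exact (this.eventually (Metric.ball_mem_nhds z hε)).filter_mono nhdsWithin_le_nhds
    have h2 : ∀ᶠ s in 𝓝[_root_.spectrum ℂ R] t, s ≠ 0 :=
      (isOpen_ne.mem_nhds ht0 : {s : ℂ | s ≠ 0} ∈ 𝓝 t) |> nhdsWithin_le_nhds
    filter_upwards [h1, h2, self_mem_nhdsWithin] with s hs1 hs2 hs3
    have := hz _ (inv_sub_one_mem_spectrum hR1 hR2 hs3 hs2) hs1
    rw [← htz] at this
    exact inv_injective (sub_left_injective this)
  -- Since t is isolated, the truncated inverse g of s - t and the indicator e of t are continuous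
  -- on the spectrum. The continuous functional calculus turns (s - t)g = 1 - e and (s - t)e = 0
  -- into operator identities.
  obtain ⟨g, hg⟩ : ∃ g : ℂ → ℂ, g = fun s => if s = t then 0 else (s - t)⁻¹ := ⟨_, rfl⟩
  obtain ⟨e, he⟩ : ∃ e : ℂ → ℂ, e = fun s => if s = t then 1 else 0 := ⟨_, rfl⟩
  have hgc : ContinuousOn g (_root_.spectrum ℂ R) := continuousOn_of_isolated hiso fun s hs => by
    have : ContinuousAt (fun s : ℂ => (s - t)⁻¹) s :=
      (continuousAt_id.sub_const t).inv₀ (sub_ne_zero.2 hs)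
    refine this.congr ?_
    filter_upwards [isOpen_ne.mem_nhds hs] with x hx
    rw [hg]
    exact (if_neg hx).symm
  have hec : ContinuousOn e (_root_.spectrum ℂ R) := continuousOn_of_isolated hiso fun s hs => by
    refine (continuousAt_const (y := 0)).congr ?_
    filter_upwards [isOpen_ne.mem_nhds hs] with x hx
    rw [he]
    exact (if_neg hx).symm
  have hRt : cfc (fun s : ℂ => s - t) R = R - algebraMap ℂ _ t := by
    rw [cfc_sub _ _ R, cfc_id' ℂ R, cfc_const t R]
  have h1 : (R - algebraMap ℂ _ t) * cfc g R = 1 - cfc e R := by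
    rw [← hRt, ← cfc_mul _ _ R, ← cfc_const_one ℂ R, ← cfc_sub _ _ R]
    refine cfc_congr fun s _ => ?_
    by_cases hs : s = t
    · simp [hg, he, hs]
    · simp [hg, he, hs, mul_inv_cancel₀ (sub_ne_zero.2 hs)]
  have h2 : (R - algebraMap ℂ _ t) * cfc e R = 0 := by
    rw [← hRt, ← cfc_mul _ _ R, ← cfc_const_zero ℂ R]
    refine cfc_congr fun s _ => ?_
    by_cases hs : s = t
    · simp [he, hs]
    · simp [he, hs]
  -- This is (A - z)R = -(z + 1)(R - t), which explains the factor -t in the reduced resolvent -t R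
  -- g(R).
  have hA' : ∀ (u : A.domain) v, (u : H) = R v → A u + (u : H) = v →
      A u - z • (u : H) = -(z + 1) • ((R - algebraMap ℂ _ t) v) := by
    intro u v hu1 hu2
    simp only [_root_.sub_apply, Algebra.algebraMap_eq_smul_one,
      _root_.smul_apply, one_apply_eq_self, ← hu1, smul_sub, smul_smul]
    rw [neg_mul, ht, mul_inv_cancel₀ hz1', neg_smul, neg_smul, add_smul, one_smul, one_smul, ← hu2]
    abel
  refine ⟨-t • (R * cfc g R), cfc e R, fun v => ?_, fun v => ?_⟩
  · obtain ⟨u, hu1, hu2⟩ := hR2 (cfc g R v)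
    refine ⟨-t • u, ?_, ?_⟩
    · rw [Submodule.coe_smul, hu1]; rfl
    · have h3 := congrArg (fun T : H →L[ℂ] H => T v) h1
      simp only [mul_apply_eq_comp, _root_.sub_apply (1 : H →L[ℂ] H),
        one_apply_eq_self] at h3
      rw [map_smul, Submodule.coe_smul, smul_comm z, ← smul_sub, hA' u _ hu1 hu2, h3, smul_smul,
        neg_mul_neg, ht, inv_mul_cancel₀ hz1', one_smul]
  · obtain ⟨u, hu1, hu2⟩ := hR2 (cfc e R v)
    have h3 := congrArg (fun T : H →L[ℂ] H => T v) h2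
    simp only [mul_apply_eq_comp, _root_.zero_apply] at h3
    have h4 := hA' u _ hu1 hu2
    rw [h3, smul_zero, sub_eq_zero] at h4
    refine mem_eigenspace.2 ⟨t⁻¹ • u, ?_, ?_⟩
    · simp only [_root_.sub_apply, Algebra.algebraMap_eq_smul_one,
        _root_.smul_apply, one_apply_eq_self, ← hu1, sub_eq_zero] at h3
      rw [Submodule.coe_smul, h3, smul_smul, inv_mul_cancel₀ ht0, one_smul]
    · rw [map_smul, Submodule.coe_smul, h4, smul_comm]

end IsNonnegSelfAdjoint
end LinearPMap

/-! ### Weakly null sequences and finite rank operators -/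

theorem tendsto_clm_apply_of_finiteDimensional_range {H : Type*} [NormedAddCommGroup H]
    [InnerProductSpace ℂ H] [CompleteSpace H] {N : Submodule ℂ H} [FiniteDimensional ℂ N]
    {T : H →L[ℂ] H} (hT : ∀ v, T v ∈ N) {f : ℕ → H}
    (hf : ∀ v, Filter.Tendsto (fun n => inner ℂ v (f n)) Filter.atTop (nhds 0)) :
    Filter.Tendsto (fun n => T (f n)) Filter.atTop (nhds 0) := by
  let b := stdOrthonormalBasis ℂ N
  have h1 : ∀ n, T (f n) = ∑ i, (inner ℂ (T.adjoint (b i : H)) (f n)) • (b i : H) := by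
    intro n
    have h2 := congrArg (fun x : N => (x : H)) (b.sum_repr' ⟨T (f n), hT _⟩)
    simp only [Submodule.coe_sum, Submodule.coe_smul, Submodule.coe_inner] at h2
    rw [← h2]
    refine Finset.sum_congr rfl fun i _ => ?_
    rw [ContinuousLinearMap.adjoint_inner_left]
  simp only [h1]
  have h3 : Filter.Tendsto (fun n => ∑ i, (inner ℂ (T.adjoint (b i : H)) (f n)) • (b i : H))
      Filter.atTop (nhds (∑ i, (0 : ℂ) • (b i : H))) :=
    tendsto_finsetSum _ fun i _ => (hf _).smul_const _
  simpa using h3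

/-- A vector of the dense union is eventually orthogonal to the sequence; the unit norms allow
approximation of an arbitrary v. -/
theorem tendsto_inner_of_mem_orthogonal {H : Type*} [NormedAddCommGroup H]
    [InnerProductSpace ℂ H] {F : ℕ → Submodule ℂ H} (hF : Monotone F)
    (hd : Dense {x | ∃ n, x ∈ F n}) {f : ℕ → H} (h1 : ∀ n, ‖f n‖ = 1) (h2 : ∀ n, f n ∈ (F n)ᗮ)
    (v : H) : Filter.Tendsto (fun n => inner ℂ v (f n)) Filter.atTop (nhds 0) := by
  rw [Metric.tendsto_atTop]
  intro ε hε
  obtain ⟨c, ⟨n, hn⟩, hc⟩ := hd.exists_dist_lt v hε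
  refine ⟨n, fun m hm => ?_⟩
  have h3 : inner ℂ c (f m) = 0 := (Submodule.mem_orthogonal _ _).1 (h2 m) c (hF hm hn)
  rw [dist_zero_right, ← sub_zero (inner ℂ v (f m)), ← h3, ← inner_sub_left]
  refine (norm_inner_le_norm _ _).trans_lt ?_
  rwa [h1, mul_one, ← dist_eq_norm]

/-! ### Variational characterization of the bottom of the spectrum -/

namespace LinearPMap

open Filter Topology

variable {H : Type*} [NormedAddCommGroup H] [InnerProductSpace ℂ H] {A : H →ₗ.[ℂ] H}

theorem IsFormCore.lowerBound {C : Submodule ℂ H} (hC : A.IsFormCore C) {μ : ℝ}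
    (h : ∀ φ : A.domain, (φ : H) ∈ C → μ * ‖(φ : H)‖ ^ 2 ≤ (inner ℂ (A φ) (φ : H)).re)
    (u : A.domain) : μ * ‖(u : H)‖ ^ 2 ≤ (inner ℂ (A u) (u : H)).re := by
  obtain ⟨φ, h1, h2, h3⟩ := hC.approx u
  exact le_of_tendsto_of_tendsto' ((h2.norm.pow 2).const_mul μ) h3 fun n => h _ (h1 n)

namespace IsNonnegSelfAdjoint

/-- The form of A - z expanded at f - t h; symmetry of A and reality of z merge the two cross terms.
Its linear term drives `false_of_minimizing`. -/
theorem re_inner_sub_smul (hA : A.IsNonnegSelfAdjoint) (z t : ℝ) (f h : A.domain) :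
    (inner ℂ (A (f - (t : ℂ) • h) - (z : ℂ) • ((f - (t : ℂ) • h : A.domain) : H))
        ((f - (t : ℂ) • h : A.domain) : H)).re =
      (inner ℂ (A f) (f : H)).re - z * ‖(f : H)‖ ^ 2
        - 2 * t * (inner ℂ (A h - (z : ℂ) • (h : H)) (f : H)).re
        + t ^ 2 * (inner ℂ (A h - (z : ℂ) • (h : H)) (h : H)).re := by
  have h1 : (inner ℂ (A f - (z : ℂ) • (f : H)) (h : H)).re =
      (inner ℂ (A h - (z : ℂ) • (h : H)) (f : H)).re := by
    rw [inner_sub_left, inner_smul_left, inner_sub_left, inner_smul_left, hA.symm,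
      ← inner_conj_symm (f : H) (A h), ← inner_conj_symm (f : H) (h : H), Complex.conj_ofReal,
      Complex.sub_re, Complex.sub_re, Complex.re_ofReal_mul, Complex.re_ofReal_mul,
      Complex.conj_re, Complex.conj_re]
  have h2 : A (f - (t : ℂ) • h) - (z : ℂ) • ((f - (t : ℂ) • h : A.domain) : H) =
      (A f - (z : ℂ) • (f : H)) - (t : ℂ) • (A h - (z : ℂ) • (h : H)) := by
    rw [LinearPMap.map_sub, LinearPMap.map_smul, Submodule.coe_sub, Submodule.coe_smul]
    module
  have h3 := re_inner_sub (z : ℂ) f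
  rw [Complex.ofReal_re] at h3
  rw [h2, Submodule.coe_sub, Submodule.coe_smul, inner_sub_left, inner_sub_right, inner_sub_right,
    inner_smul_left, inner_smul_left, inner_smul_right, inner_smul_right, Complex.conj_ofReal,
    Complex.sub_re, Complex.sub_re, Complex.sub_re, Complex.re_ofReal_mul, Complex.re_ofReal_mul,
    Complex.re_ofReal_mul, Complex.re_ofReal_mul, h1, h3]
  ring

/-- A minimizing sequence `f` for the form of `A - z` cannot be asymptotically in the image of a
bounded sequence under `A - z`. -/
theorem false_of_minimizing (hA : A.IsNonnegSelfAdjoint) {z M : ℝ} {f h : ℕ → A.domain}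
    (hf : ∀ n, ‖(f n : H)‖ = 1) (hh : ∀ n, ‖(h n : H)‖ ≤ M)
    (he : Tendsto (fun n => A (h n) - (z : ℂ) • (h n : H) - f n) atTop (𝓝 0))
    (hq : Tendsto (fun n => (inner ℂ (A (f n)) (f n : H)).re) atTop (𝓝 z))
    (hpos : ∀ t ε : ℝ, 0 < t → 0 < ε → ∀ᶠ n in atTop,
      -ε ≤ (inner ℂ (A (f n - (t : ℂ) • h n) - (z : ℂ) • ((f n - (t : ℂ) • h n : A.domain) : H))
        ((f n - (t : ℂ) • h n : A.domain) : H)).re) : False := by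
  have hM : 0 ≤ M := (norm_nonneg _).trans (hh 0)
  -- If (A - z)h ≈ f, the form of A - z at f - t h is about -2t plus a term of size t²M. This t
  -- keeps the quadratic term below 5t/8 even with the error 1/4 in (A - z)h, so the value falls
  -- below -t/4, against `hpos`.
  obtain ⟨t, ht⟩ : ∃ t : ℝ, t = 1 / (2 * (M + 1)) := ⟨_, rfl⟩
  have ht0 : 0 < t := by rw [ht]; positivity
  have htM : t * M ≤ 1 / 2 := by
    rw [ht, div_mul_eq_mul_div, div_le_div_iff₀ (by positivity) (by norm_num)]
    linarith
  have e1 : ∀ᶠ n in atTop, ‖A (h n) - (z : ℂ) • (h n : H) - f n‖ < 1 / 4 := by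
    have := he.norm
    rw [norm_zero] at this
    exact this.eventually_lt_const (by norm_num)
  have e2 : ∀ᶠ n in atTop, (inner ℂ (A (f n)) (f n : H)).re < z + t / 4 :=
    hq.eventually_lt_const (by linarith)
  obtain ⟨n, h1, h2, h3⟩ := (e1.and (e2.and (hpos t (t / 4) ht0 (by linarith)))).exists
  rw [hA.re_inner_sub_smul, hf] at h3
  obtain ⟨e, hedef⟩ : ∃ e, e = A (h n) - (z : ℂ) • (h n : H) - f n := ⟨_, rfl⟩
  have hee : A (h n) - (z : ℂ) • (h n : H) = f n + e := by rw [hedef]; abel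
  rw [← hedef] at h1
  rw [hee, inner_add_left, Complex.add_re, inner_self_eq_ofReal, Complex.ofReal_re, hf] at h3
  have h4 : -(1 / 4) ≤ (inner ℂ e (f n : H)).re := by
    have := (Complex.abs_re_le_norm _).trans (norm_inner_le_norm (𝕜 := ℂ) e (f n : H))
    rw [hf, mul_one] at this
    linarith [(abs_le.1 this).1]
  have h5 : (inner ℂ ((f n : H) + e) (h n : H)).re ≤ 5 / 4 * M := by
    refine ((Complex.re_le_norm _).trans (norm_inner_le_norm (𝕜 := ℂ) _ _)).trans ?_
    have h6 : ‖(f n : H) + e‖ ≤ 5 / 4 := by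
      refine (norm_add_le _ _).trans ?_
      rw [hf]
      linarith
    exact mul_le_mul h6 (hh n) (norm_nonneg _) (by norm_num)
  have h7 : t ^ 2 * (inner ℂ ((f n : H) + e) (h n : H)).re ≤ t * (5 / 8) := by
    calc t ^ 2 * (inner ℂ ((f n : H) + e) (h n : H)).re ≤ t ^ 2 * (5 / 4 * M) := by gcongr
      _ = t * (5 / 4 * (t * M)) := by ring
      _ ≤ t * (5 / 4 * (1 / 2)) := by gcongr
      _ = _ := by ring
  nlinarith

/-- Here z is the supremum over n of the lower bounds valid on C n, and the sequence is diagonal: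
its n-th term is taken in C n with form below z + 1/(n + 1). A constant C serves the spectrum, a
decreasing one the essential spectrum. -/
theorem exists_minimizing_sequence (hA : A.IsNonnegSelfAdjoint) {C : ℕ → Submodule ℂ H}
    (hC : Antitone C) {l : ℝ}
    (hl : ∀ n, ∀ μ > l, ¬ ∀ φ : A.domain, (φ : H) ∈ C n →
      μ * ‖(φ : H)‖ ^ 2 ≤ (inner ℂ (A φ) (φ : H)).re) :
    ∃ z : ℝ, 0 ≤ z ∧ z ≤ l ∧
      (∀ μ < z, ∃ n, ∀ φ : A.domain, (φ : H) ∈ C n →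
        μ * ‖(φ : H)‖ ^ 2 ≤ (inner ℂ (A φ) (φ : H)).re) ∧
      ∃ f : ℕ → A.domain, (∀ n, (f n : H) ∈ C n) ∧ (∀ n, ‖(f n : H)‖ = 1) ∧
        Tendsto (fun n => (inner ℂ (A (f n)) (f n : H)).re) atTop (𝓝 z) := by
  let S : Set ℝ := {μ | ∃ n, ∀ φ : A.domain, (φ : H) ∈ C n →
    μ * ‖(φ : H)‖ ^ 2 ≤ (inner ℂ (A φ) (φ : H)).re}
  have h0 : (0 : ℝ) ∈ S := ⟨0, fun φ _ => by rw [zero_mul]; exact hA.nonneg φ⟩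
  have hb : ∀ μ ∈ S, μ ≤ l := fun μ ⟨n, hn⟩ => by
    by_contra! h
    exact hl n μ h hn
  have hbdd : BddAbove S := ⟨l, hb⟩
  have hlow : ∀ μ < sSup S, ∃ n, ∀ φ : A.domain, (φ : H) ∈ C n →
      μ * ‖(φ : H)‖ ^ 2 ≤ (inner ℂ (A φ) (φ : H)).re := by
    intro μ hμ
    obtain ⟨ν, ⟨n, hn⟩, hν⟩ := exists_lt_of_lt_csSup ⟨0, h0⟩ hμ
    exact ⟨n, fun φ hφ => le_trans (by gcongr) (hn φ hφ)⟩
  refine ⟨sSup S, le_csSup hbdd h0, csSup_le ⟨0, h0⟩ hb, hlow, ?_⟩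
  have hf : ∀ n : ℕ, ∃ f : A.domain, (f : H) ∈ C n ∧ ‖(f : H)‖ = 1 ∧
      (inner ℂ (A f) (f : H)).re < sSup S + 1 / ((n : ℝ) + 1) := by
    intro n
    by_contra! hcon
    have : sSup S + 1 / ((n : ℝ) + 1) ∈ S := by
      refine ⟨n, fun φ hφ => ?_⟩
      by_cases h : (φ : H) = 0
      · rw [h]
        simp
      · have hn : 0 < ‖(φ : H)‖ := norm_pos_iff.2 h
        have h1 := hcon (((‖(φ : H)‖⁻¹ : ℝ) : ℂ) • φ) ((C n).smul_mem _ hφ) (by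
          rw [Submodule.coe_smul, norm_smul, Complex.norm_real, norm_inv, norm_norm,
            inv_mul_cancel₀ hn.ne'])
        rw [LinearPMap.map_smul, Submodule.coe_smul, inner_smul_left, inner_smul_right,
          Complex.conj_ofReal, Complex.re_ofReal_mul, Complex.re_ofReal_mul, ← mul_assoc,
          ← mul_inv, inv_mul_eq_div, le_div_iff₀ (by positivity)] at h1
        rwa [sq]
    have h2 := le_csSup hbdd this
    have h3 : 0 < 1 / ((n : ℝ) + 1) := by positivity
    linarith
  choose f hf1 hf2 hf3 using hf
  refine ⟨f, hf1, hf2, ?_⟩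
  rw [tendsto_order]
  refine ⟨fun μ hμ => ?_, fun μ hμ => ?_⟩
  · obtain ⟨ν, hν1, hν2⟩ := exists_between hμ
    obtain ⟨n, hn⟩ := hlow ν hν2
    filter_upwards [eventually_ge_atTop n] with m hm
    have := hn (f m) (hC hm (hf1 m))
    rw [hf2] at this
    linarith
  · have h4 : Tendsto (fun n : ℕ => sSup S + 1 / ((n : ℝ) + 1)) atTop (𝓝 (sSup S + 0)) :=
      tendsto_one_div_add_atTop_nhds_zero_nat.const_add _
    rw [add_zero] at h4
    filter_upwards [h4.eventually_lt_const hμ] with n hn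
    exact (hf3 n).trans hn

/-- The bottom of the spectrum is the infimum of the quadratic form on a core. -/
theorem coe_lt_spectralBottom_spectrum_iff [CompleteSpace H] (hA : A.IsNonnegSelfAdjoint)
    {C : Submodule ℂ H} (hC : A.IsFormCore C) {l : ℝ} :
    (l : EReal) < spectralBottom A.spectrum ↔ ∃ μ > l, ∀ φ : A.domain, (φ : H) ∈ C →
      μ * ‖(φ : H)‖ ^ 2 ≤ (inner ℂ (A φ) (φ : H)).re := by
  constructor
  · intro hl
    by_contra! hcon
    obtain ⟨z, -, hzl, hlow, f, hf1, hf2, hf3⟩ :=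
      hA.exists_minimizing_sequence (C := fun _ => C) (l := l) antitone_const
        (fun _ μ hμ h => by
          obtain ⟨φ, h1, h2⟩ := hcon μ hμ
          exact absurd (h φ h1) (not_le.2 h2))
    have hz : (z : ℂ) ∈ A.spectrum := by
      rintro ⟨T, hT1, hT2⟩
      -- If z were in the resolvent set, the resolvent applied to the minimizing sequence would
      -- solve (A - z)h = f exactly and boundedly.
      choose h hh1 hh2 using fun n => hT2 (f n)
      refine hA.false_of_minimizing (h := h) (M := ‖T‖) hf2 (fun n => ?_) ?_ hf3 ?_
      · rw [hh1]
        exact (T.le_opNorm _).trans (by rw [hf2, mul_one])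
      · simp only [hh2, sub_self]
        exact tendsto_const_nhds
      · intro t ε _ hε
        refine Eventually.of_forall fun n => ?_
        rw [re_inner_sub, Complex.ofReal_re]
        refine le_trans (by linarith) (sub_nonneg.2 (hC.lowerBound (fun φ hφ => ?_) _))
        -- The bounds are known only for constants below z, so the bound with z itself is reached by
        -- approximation from below.
        refine le_of_forall_lt_imp_le_of_dense fun a ha => ?_
        by_cases h0 : ‖(φ : H)‖ ^ 2 = 0
        · rw [h0, mul_zero] at ha
          exact ha.le.trans (hA.nonneg φ)
        · have hp : 0 < ‖(φ : H)‖ ^ 2 := lt_of_le_of_ne (sq_nonneg _) (Ne.symm h0)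
          obtain ⟨n, hn⟩ := hlow (a / ‖(φ : H)‖ ^ 2) (by rwa [div_lt_iff₀ hp])
          have := hn φ hφ
          rwa [div_mul_cancel₀ _ h0] at this
    have h1 : spectralBottom A.spectrum ≤ ((z : ℂ).re : ℝ) := iInf₂_le (z : ℂ) hz
    rw [Complex.ofReal_re] at h1
    exact absurd (hl.trans_le h1) (not_lt.2 (EReal.coe_le_coe_iff.2 hzl))
  · rintro ⟨μ, hμ, h⟩
    refine (EReal.coe_lt_coe_iff.2 hμ).trans_le (le_iInf₂ fun z hz => ?_)
    exact EReal.coe_le_coe_iff.2 (hA.le_re_of_mem_spectrum (hC.lowerBound h) hz)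

end IsNonnegSelfAdjoint
end LinearPMap

/-! ### Finite-dimensional perturbations and Persson's theorem -/

namespace LinearPMap

open Filter Topology

variable {H : Type*} [NormedAddCommGroup H] [InnerProductSpace ℂ H] {A : H →ₗ.[ℂ] H}

/-- A lower bound of the form on the orthogonal complement of a finite-dimensional space extends to
the whole domain, up to an error controlled by the projection onto that space. -/
theorem IsFormCore.exists_lowerBound_sub (hA : A.IsNonnegSelfAdjoint) {C : Submodule ℂ H}
    (hC : A.IsFormCore C) (F : Submodule ℂ H) [FiniteDimensional ℂ F] (hF : F ≤ C) {μ : ℝ}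
    (h : ∀ φ : A.domain, (φ : H) ∈ C → (φ : H) ∈ Fᗮ →
      μ * ‖(φ : H)‖ ^ 2 ≤ (inner ℂ (A φ) (φ : H)).re) :
    ∃ K : ℝ, 0 ≤ K ∧ ∀ w : A.domain,
      μ * ‖(w : H)‖ ^ 2 - K * ‖F.starProjection (w : H)‖ * ‖(w : H)‖ ≤
        (inner ℂ (A w) (w : H)).re := by
  let T : F →L[ℂ] H :=
    LinearMap.toContinuousLinearMap (A.toFun ∘ₗ Submodule.inclusion (hF.trans hC.le))
  -- For p the projection of φ onto F, the form at φ is the form at φ - p plus 2 Re⟨Ap, φ⟩ - Re⟨Ap,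
  -- p⟩. As A is bounded on F, this costs three terms of size ‖T‖‖p‖‖φ‖; the |μ| pays for μ‖p‖² in
  -- Pythagoras.
  refine ⟨3 * ‖T‖ + |μ|, by positivity, fun w => ?_⟩
  obtain ⟨f, hf1, hf2, hf3⟩ := hC.approx w
  have hlim : Tendsto (fun n => μ * ‖(f n : H)‖ ^ 2 -
      (3 * ‖T‖ + |μ|) * ‖F.starProjection (f n : H)‖ * ‖(f n : H)‖) atTop
      (𝓝 (μ * ‖(w : H)‖ ^ 2 - (3 * ‖T‖ + |μ|) * ‖F.starProjection (w : H)‖ * ‖(w : H)‖)) :=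
    ((hf2.norm.pow 2).const_mul μ).sub
      ((((F.starProjection.continuous.tendsto _).comp hf2).norm.const_mul _).mul hf2.norm)
  refine le_of_tendsto_of_tendsto' hlim hf3 fun n => ?_
  generalize hφ : f n = φ
  have hφC : (φ : H) ∈ C := hφ ▸ hf1 n
  obtain ⟨x, hx⟩ : ∃ x : F, (x : H) = F.starProjection (φ : H) :=
    ⟨⟨_, F.starProjection_apply_mem _⟩, rfl⟩
  obtain ⟨p, hp⟩ : ∃ p : A.domain, p = Submodule.inclusion (hF.trans hC.le) x := ⟨_, rfl⟩
  have hpx : (p : H) = x := by rw [hp]; rfl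
  have hAp : ‖A p‖ ≤ ‖T‖ * ‖(p : H)‖ := by
    have : A p = T x := by rw [hp]; rfl
    rw [this, hpx]
    exact T.le_opNorm x
  have horth : ((φ - p : A.domain) : H) ∈ Fᗮ := by
    rw [Submodule.coe_sub, hpx, hx]
    exact F.sub_starProjection_mem_orthogonal _
  have hpF : (p : H) ∈ F := hpx ▸ x.2
  have h1 := h (φ - p) (C.sub_mem hφC (hF hpF)) horth
  have h2 := hA.re_inner_sub_smul 0 1 φ p
  simp only [Complex.ofReal_one, one_smul, Complex.ofReal_zero, zero_smul, sub_zero, zero_mul,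
    mul_one, one_pow, one_mul] at h2
  rw [h2] at h1
  have h3 : ‖(φ : H)‖ ^ 2 = ‖((φ - p : A.domain) : H)‖ ^ 2 + ‖(p : H)‖ ^ 2 := by
    have h4 : (φ : H) = ((φ - p : A.domain) : H) + p := by simp
    have h5 := norm_add_sq_eq_norm_sq_add_norm_sq_of_inner_eq_zero (𝕜 := ℂ)
      ((φ - p : A.domain) : H) (p : H) (Submodule.inner_left_of_mem_orthogonal hpF horth)
    rw [← h4] at h5
    nlinarith
  have h6 : ‖(p : H)‖ ≤ ‖(φ : H)‖ := by
    by_contra! h7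
    nlinarith [norm_nonneg (φ : H), sq_nonneg ‖((φ - p : A.domain) : H)‖]
  have h8 : -(‖T‖ * ‖(p : H)‖ * ‖(φ : H)‖) ≤ (inner ℂ (A p) (φ : H)).re := by
    have := (abs_le.1 ((Complex.abs_re_le_norm _).trans (norm_inner_le_norm (𝕜 := ℂ) (A p) φ))).1
    nlinarith [mul_le_mul_of_nonneg_right hAp (norm_nonneg (φ : H))]
  have h9 : (inner ℂ (A p) (p : H)).re ≤ ‖T‖ * ‖(p : H)‖ * ‖(φ : H)‖ := by
    refine ((Complex.re_le_norm _).trans (norm_inner_le_norm (𝕜 := ℂ) _ _)).trans ?_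
    exact mul_le_mul hAp h6 (norm_nonneg _) (by positivity)
  have h10 : μ * ‖(p : H)‖ ^ 2 ≤ |μ| * ‖(p : H)‖ * ‖(φ : H)‖ := by
    calc μ * ‖(p : H)‖ ^ 2 ≤ |μ| * ‖(p : H)‖ ^ 2 := by gcongr; exact le_abs_self μ
      _ = |μ| * ‖(p : H)‖ * ‖(p : H)‖ := by ring
      _ ≤ _ := by gcongr
  have h11 : μ * ‖(φ : H)‖ ^ 2 = μ * ‖((φ - p : A.domain) : H)‖ ^ 2 + μ * ‖(p : H)‖ ^ 2 := by
    rw [h3, mul_add]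
  have h12 : (3 * ‖T‖ + |μ|) * ‖(p : H)‖ * ‖(φ : H)‖ =
      3 * (‖T‖ * ‖(p : H)‖ * ‖(φ : H)‖) + |μ| * ‖(p : H)‖ * ‖(φ : H)‖ := by ring
  rw [← hx, ← hpx]
  linarith

namespace IsNonnegSelfAdjoint

section Discrete

variable {F : Submodule ℂ H} [FiniteDimensional ℂ F] {μ K : ℝ}

/-- Pair (A - z)w with w and divide by ‖w‖. For Re z < μ this bounds w by (A - z)w modulo a finite
rank term, the source of all compactness below μ. -/
theorem norm_le_add_starProjection (hK : ∀ w : A.domain,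
      μ * ‖(w : H)‖ ^ 2 - K * ‖F.starProjection (w : H)‖ * ‖(w : H)‖ ≤
        (inner ℂ (A w) (w : H)).re) (z : ℂ) (w : A.domain) :
    (μ - z.re) * ‖(w : H)‖ ≤ ‖A w - z • (w : H)‖ + K * ‖F.starProjection (w : H)‖ := by
  rcases (norm_nonneg (w : H)).eq_or_lt with h0 | h0
  · have : (w : H) = 0 := norm_eq_zero.1 h0.symm
    rw [this, norm_zero, mul_zero, _root_.map_zero, norm_zero, mul_zero, add_zero]
    exact norm_nonneg _
  · have h1 := (Complex.re_le_norm _).trans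
      (norm_inner_le_norm (𝕜 := ℂ) (A w - z • (w : H)) (w : H))
    rw [re_inner_sub] at h1
    have h2 := hK w
    by_contra! h3
    nlinarith [mul_lt_mul_of_pos_right h3 h0]

/-- An eigenvector with zero projection onto F vanishes, so the eigenspace embeds in F. -/
theorem finiteDimensional_eigenspace (hK : ∀ w : A.domain,
      μ * ‖(w : H)‖ ^ 2 - K * ‖F.starProjection (w : H)‖ * ‖(w : H)‖ ≤
        (inner ℂ (A w) (w : H)).re) {z : ℂ} (hz : z.re < μ) :
    FiniteDimensional ℂ (A.eigenspace z) := by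
  let P : A.eigenspace z →ₗ[ℂ] F :=
    (F.orthogonalProjectionOnto : H →ₗ[ℂ] F) ∘ₗ (A.eigenspace z).subtype
  refine FiniteDimensional.of_injective P ((injective_iff_map_eq_zero P).2 fun x hx => ?_)
  obtain ⟨u, hu1, hu2⟩ := mem_eigenspace.1 x.2
  have h1 := norm_le_add_starProjection hK z u
  have h2 : F.starProjection (u : H) = 0 := by
    rw [hu1]
    exact congrArg (fun y : F => (y : H)) hx
  rw [hu2, sub_self, h2, norm_zero, mul_zero, add_zero] at h1
  have h3 : ‖(u : H)‖ = 0 := le_antisymm (by nlinarith) (norm_nonneg _)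
  rw [norm_eq_zero, hu1] at h3
  exact Subtype.ext h3

/-- The projections onto the finite-dimensional F converge along a subsequence. The estimate
`norm_le_add_starProjection`, applied to differences, then makes the vectors themselves Cauchy, and
closedness of A identifies the limit. -/
theorem exists_tendsto_eigenvector [CompleteSpace H] (hA : A.IsNonnegSelfAdjoint)
    (hK0 : 0 ≤ K) (hK : ∀ w : A.domain,
      μ * ‖(w : H)‖ ^ 2 - K * ‖F.starProjection (w : H)‖ * ‖(w : H)‖ ≤
        (inner ℂ (A w) (w : H)).re) {z : ℂ} (hz : z.re < μ) {w : ℕ → A.domain}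
    (hw : ∀ n, ‖(w n : H)‖ = 1)
    (hr : Tendsto (fun n => A (w n) - z • (w n : H)) atTop (𝓝 0)) :
    ∃ x ∈ A.eigenspace z, ‖x‖ = 1 ∧
      ∃ σ : ℕ → ℕ, StrictMono σ ∧ Tendsto (fun n => (w (σ n) : H)) atTop (𝓝 x) := by
  have : ProperSpace F := FiniteDimensional.proper ℂ F
  obtain ⟨p, -, σ, hσ, hp⟩ := tendsto_subseq_of_bounded (Metric.isBounded_closedBall
    (x := (0 : F)) (r := 1)) (x := fun n => F.orthogonalProjectionOnto (w n : H)) (fun n => by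
      rw [mem_closedBall_zero_iff]
      exact (F.norm_orthogonalProjectionOnto_apply_le _).trans (hw n).le)
  have hcau : CauchySeq fun n => (w (σ n) : H) := by
    rw [Metric.cauchySeq_iff]
    intro ε hε
    have hd : 0 < μ - z.re := sub_pos.2 hz
    obtain ⟨δ, hδ⟩ : ∃ δ, δ = (μ - z.re) * ε / (2 * (K + 1)) := ⟨_, rfl⟩
    have hδ0 : 0 < δ := by rw [hδ]; positivity
    obtain ⟨N, hN⟩ := eventually_atTop.1
      ((Metric.tendsto_nhds.1 hp δ hδ0).and
        (Metric.tendsto_nhds.1 (hr.comp hσ.tendsto_atTop) δ hδ0))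
    refine ⟨N, fun m hm n hn => ?_⟩
    obtain ⟨a1, a2⟩ := hN m hm
    obtain ⟨b1, b2⟩ := hN n hn
    simp only [Function.comp_apply, dist_zero_right] at a1 a2 b1 b2
    have h1 := norm_le_add_starProjection hK z (w (σ m) - w (σ n))
    have h2 : ‖A (w (σ m) - w (σ n)) - z • ((w (σ m) - w (σ n) : A.domain) : H)‖ < 2 * δ := by
      have : A (w (σ m) - w (σ n)) - z • ((w (σ m) - w (σ n) : A.domain) : H) =
          (A (w (σ m)) - z • (w (σ m) : H)) - (A (w (σ n)) - z • (w (σ n) : H)) := by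
        rw [LinearPMap.map_sub, Submodule.coe_sub, smul_sub]
        abel
      rw [this]
      refine (norm_sub_le _ _).trans_lt ?_
      linarith
    have h3 : ‖F.starProjection ((w (σ m) - w (σ n) : A.domain) : H)‖ ≤ 2 * δ := by
      have : F.starProjection ((w (σ m) - w (σ n) : A.domain) : H) =
          ((F.orthogonalProjectionOnto (w (σ m) : H) -
            F.orthogonalProjectionOnto (w (σ n) : H) : F) : H) := by
        rw [← _root_.map_sub, Submodule.coe_sub]
        rfl
      rw [this]
      change ‖(F.orthogonalProjectionOnto (w (σ m) : H) -
        F.orthogonalProjectionOnto (w (σ n) : H) : F)‖ ≤ _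
      rw [← dist_eq_norm]
      refine (dist_triangle_right _ _ p).trans ?_
      linarith
    rw [Submodule.coe_sub, ← dist_eq_norm] at h1
    have h4 : K * ‖F.starProjection ((w (σ m) : H) - w (σ n))‖ ≤ K * (2 * δ) := by
      rw [← Submodule.coe_sub]
      gcongr
    rw [← Submodule.coe_sub] at h1 h4
    have h5 : (μ - z.re) * ε = δ * (2 * (K + 1)) := by
      rw [hδ]
      field_simp
    refine lt_of_mul_lt_mul_left (a := μ - z.re) ?_ hd.le
    linarith
  obtain ⟨x, hx⟩ := cauchySeq_tendsto_of_complete hcau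
  refine ⟨x, hA.exists_eigenvector_of_tendsto hx (hr.comp hσ.tendsto_atTop), ?_, σ, hσ, hx⟩
  have := hx.norm
  simp only [hw] at this
  exact tendsto_nhds_unique this tendsto_const_nhds |>.symm ▸ rfl

theorem eigenspace_orthogonal (hA : A.IsNonnegSelfAdjoint) {z z' : ℂ} (hz : z.im = 0)
    (hne : z ≠ z') {x y : H} (hx : x ∈ A.eigenspace z) (hy : y ∈ A.eigenspace z') :
    inner ℂ x y = 0 := by
  obtain ⟨u, rfl, hu⟩ := mem_eigenspace.1 hx
  obtain ⟨v, rfl, hv⟩ := mem_eigenspace.1 hy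
  have h := hA.symm u v
  rw [hu, hv, inner_smul_left, inner_smul_right, Complex.conj_eq_iff_im.2 hz] at h
  have h2 : (z - z') * inner ℂ (u : H) (v : H) = 0 := by rw [sub_mul, h, sub_self]
  exact (mul_eq_zero.1 h2).resolve_left (sub_ne_zero.2 hne)

theorem exists_unit_eigenvector [CompleteSpace H] (hA : A.IsNonnegSelfAdjoint)
    (hK0 : 0 ≤ K) (hK : ∀ w : A.domain,
      μ * ‖(w : H)‖ ^ 2 - K * ‖F.starProjection (w : H)‖ * ‖(w : H)‖ ≤
        (inner ℂ (A w) (w : H)).re) {z : ℂ} (hz : z.re < μ) (hzs : z ∈ A.spectrum) :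
    ∃ x ∈ A.eigenspace z, ‖x‖ = 1 := by
  choose w hw1 hw2 using fun n : ℕ =>
    hA.exists_approx_eigenvector hzs (ε := 1 / ((n : ℝ) + 1)) (by positivity)
  obtain ⟨x, hx1, hx2, -⟩ := hA.exists_tendsto_eigenvector hK0 hK hz hw1
    (squeeze_zero_norm (fun n => (hw2 n).le) tendsto_one_div_add_atTop_nhds_zero_nat)
  exact ⟨x, hx1, hx2⟩

/-- If z were not isolated, unit eigenvectors for nearby spectral points y ≠ z would be approximate
eigenvectors at z. A subsequence would converge to a unit eigenvector of z to which every term is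
orthogonal, which is impossible. -/
theorem mem_discreteSpectrum [CompleteSpace H] (hA : A.IsNonnegSelfAdjoint)
    (hK0 : 0 ≤ K) (hK : ∀ w : A.domain,
      μ * ‖(w : H)‖ ^ 2 - K * ‖F.starProjection (w : H)‖ * ‖(w : H)‖ ≤
        (inner ℂ (A w) (w : H)).re) {z : ℂ} (hz : z.re < μ) (hzs : z ∈ A.spectrum) :
    z ∈ A.discreteSpectrum := by
  refine ⟨hzs, ?_, ?_, finiteDimensional_eigenspace hK hz⟩
  · by_contra! hcon
    have h1 : ∀ n : ℕ, ∃ y : ℂ, y ∈ A.spectrum ∧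
        dist y z < min (μ - z.re) (1 / ((n : ℝ) + 1)) ∧ y ≠ z :=
      fun n => hcon _ (lt_min (sub_pos.2 hz) (by positivity))
    choose y hy1 hy2 hy3 using h1
    have h2 : ∀ n, (y n).re < μ := fun n => by
      have h3 := (Complex.re_le_norm (y n - z)).trans_lt
        ((dist_eq_norm (y n) z) ▸ (hy2 n).trans_le (min_le_left _ _))
      rw [Complex.sub_re] at h3
      linarith
    choose x hx1 hx2 using fun n => hA.exists_unit_eigenvector hK0 hK (h2 n) (hy1 n)
    choose w hw1 hw2 using fun n => mem_eigenspace.1 (hx1 n)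
    obtain ⟨v, hv1, hv2, σ, -, hv3⟩ := hA.exists_tendsto_eigenvector hK0 hK hz (w := w)
      (fun n => by rw [hw1, hx2])
      (squeeze_zero_norm (fun n => by
        rw [hw2, ← sub_smul, norm_smul, hw1, hx2, mul_one, ← dist_eq_norm]
        exact ((hy2 n).trans_le (min_le_right _ _)).le) tendsto_one_div_add_atTop_nhds_zero_nat)
    have h4 : ∀ n, inner ℂ (w (σ n) : H) v = 0 := fun n => by
      rw [hw1]
      exact hA.eigenspace_orthogonal (hA.mem_spectrum_real (hy1 _)) (hy3 _) (hx1 _) hv1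
    have h5 := hv3.inner (tendsto_const_nhds (x := v)) (𝕜 := ℂ)
    simp only [h4] at h5
    have h6 := tendsto_nhds_unique h5 tendsto_const_nhds
    rw [inner_self_eq_zero] at h6
    rw [h6, norm_zero] at hv2
    exact zero_ne_one hv2
  · obtain ⟨x, hx1, hx2⟩ := hA.exists_unit_eigenvector hK0 hK hz hzs
    intro h
    rw [h, Submodule.mem_bot] at hx1
    rw [hx1, norm_zero] at hx2
    exact zero_ne_one hx2

end Discrete

/-- Off the essential spectrum, `A - z` is invertible up to a finite rank operator. -/
theorem exists_parametrix [CompleteSpace H] (hA : A.IsNonnegSelfAdjoint) {z : ℂ} (hz1 : z ≠ -1)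
    (hz : z ∉ A.essentialSpectrum) :
    ∃ (S E : H →L[ℂ] H) (N : Submodule ℂ H), FiniteDimensional ℂ N ∧ (∀ v, E v ∈ N) ∧
      ∀ v, ∃ u : A.domain, (u : H) = S v ∧ A u - z • (u : H) = v - E v := by
  by_cases hzs : z ∈ A.spectrum
  · have hd : z ∈ A.discreteSpectrum := by
      by_contra h
      exact hz ⟨hzs, h⟩
    obtain ⟨-, ⟨ε, hε, h1⟩, -, h2⟩ := hd
    obtain ⟨S, E, h3, h4⟩ := hA.exists_reduced_resolvent hz1 hε h1
    exact ⟨S, E, _, h2, h4, h3⟩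
  · rw [spectrum, Set.notMem_compl_iff] at hzs
    obtain ⟨T, -, hT⟩ := hzs
    exact ⟨T, 0, ⊥, inferInstance, fun v => by simp, fun v => by simpa using hT v⟩

/-- Persson's theorem: the bottom of the essential spectrum is the limit of the infima of the
quadratic form on the complements of an exhausting sequence of finite-dimensional spaces. -/
theorem coe_lt_spectralBottom_essentialSpectrum_iff [CompleteSpace H] (hA : A.IsNonnegSelfAdjoint)
    {C : Submodule ℂ H} (hC : A.IsFormCore C) (hd : Dense (C : Set H)) {F : ℕ → Submodule ℂ H}
    (hfd : ∀ n, FiniteDimensional ℂ (F n)) (hmono : Monotone F) (hFC : ∀ n, F n ≤ C)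
    (hCF : ∀ x ∈ C, ∃ n, x ∈ F n) {l : ℝ} :
    (l : EReal) < spectralBottom A.essentialSpectrum ↔ ∃ n, ∃ μ > l, ∀ φ : A.domain,
      (φ : H) ∈ C → (φ : H) ∈ (F n)ᗮ → μ * ‖(φ : H)‖ ^ 2 ≤ (inner ℂ (A φ) (φ : H)).re := by
  constructor
  · intro hl
    by_contra! hcon
    obtain ⟨z, hz0, hzl, hlow, f, hf1, hf2, hf3⟩ :=
      hA.exists_minimizing_sequence (C := fun n => C ⊓ (F n)ᗮ) (l := l)
        (fun m n hmn => inf_le_inf_left _ (Submodule.orthogonal_le (hmono hmn)))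
        (fun n μ hμ h => by
          obtain ⟨φ, h1, h2, h3⟩ := hcon n μ hμ
          exact absurd (h φ ⟨h1, h2⟩) (not_le.2 h3))
    have hz : (z : ℂ) ∈ A.essentialSpectrum := by
      by_contra hz
      obtain ⟨S, E, N, hN, hE, hS⟩ := hA.exists_parametrix (by
        intro h
        have := congrArg Complex.re h
        simp at this
        linarith) hz
      -- The minimizing vectors leave every F n, so they tend weakly to zero. The finite rank error
      -- of the parametrix therefore disappears along them.
      have hweak := tendsto_inner_of_mem_orthogonal hmono
        (hd.mono fun x hx => hCF x hx) hf2 fun n => (hf1 n).2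
      choose h hh1 hh2 using fun n => hS (f n)
      have hh3 : ∀ n, ‖(h n : H)‖ ≤ ‖S‖ := fun n => by
        rw [hh1]
        exact (S.le_opNorm _).trans (by rw [hf2, mul_one])
      refine hA.false_of_minimizing (h := h) (M := ‖S‖) hf2 hh3 ?_ hf3 ?_
      · simp only [hh2, sub_sub_cancel_left]
        have := (tendsto_clm_apply_of_finiteDimensional_range hE hweak).neg
        rwa [neg_zero] at this
      · intro t ε ht hε
        obtain ⟨M, hM⟩ : ∃ M, M = 1 + t * ‖S‖ := ⟨_, rfl⟩
        have hM0 : 0 < M := by rw [hM]; positivity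
        -- On vectors of norm at most M, lowering z by this amount costs at most ε/2; the other half
        -- of ε absorbs the projection onto F k, which tends to zero by weak convergence.
        obtain ⟨k, hk⟩ := hlow (z - ε / (2 * M ^ 2)) (sub_lt_self _ (by positivity))
        have := hfd k
        obtain ⟨K, hK0, hK⟩ :=
          hC.exists_lowerBound_sub hA (F k) (hFC k) fun φ h1 h2 => hk φ ⟨h1, h2⟩
        let Q : H →L[ℂ] H :=
          (F k).starProjection ∘L (ContinuousLinearMap.id ℂ H - (t : ℂ) • S)
        have hQ : Tendsto (fun n => Q (f n)) atTop (𝓝 0) :=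
          tendsto_clm_apply_of_finiteDimensional_range (T := Q)
            (fun v => (F k).starProjection_apply_mem _) hweak
        have hQ' : Tendsto (fun n => K * ‖Q (f n)‖ * M) atTop (𝓝 0) := by
          have := (hQ.norm.const_mul K).mul_const M
          simpa using this
        filter_upwards [hQ'.eventually_lt_const (half_pos hε)] with n hn
        have e1 : Q (f n) = (F k).starProjection ((f n - (t : ℂ) • h n : A.domain) : H) := by
          rw [Submodule.coe_sub, Submodule.coe_smul, hh1]
          rfl
        have e2 : ‖((f n - (t : ℂ) • h n : A.domain) : H)‖ ≤ M := by
          rw [Submodule.coe_sub, Submodule.coe_smul]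
          refine (norm_sub_le _ _).trans ?_
          rw [norm_smul, Complex.norm_real, Real.norm_of_nonneg ht.le, hf2, hM]
          gcongr
          exact hh3 n
        have e3 := hK (f n - (t : ℂ) • h n)
        rw [← e1] at e3
        rw [re_inner_sub, Complex.ofReal_re]
        have e4 := norm_nonneg ((f n - (t : ℂ) • h n : A.domain) : H)
        generalize ‖((f n - (t : ℂ) • h n : A.domain) : H)‖ = a at e2 e3 e4 ⊢
        have e5 : K * ‖Q (f n)‖ * a ≤ K * ‖Q (f n)‖ * M := by gcongr
        have e6 : ε / (2 * M ^ 2) * a ^ 2 ≤ ε / (2 * M ^ 2) * M ^ 2 := by gcongr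
        have e7 : ε / (2 * M ^ 2) * M ^ 2 = ε / 2 := by field_simp
        rw [sub_mul] at e3
        linarith
    have h1 : spectralBottom A.essentialSpectrum ≤ ((z : ℂ).re : ℝ) := iInf₂_le (z : ℂ) hz
    rw [Complex.ofReal_re] at h1
    exact absurd (hl.trans_le h1) (not_lt.2 (EReal.coe_le_coe_iff.2 hzl))
  · rintro ⟨n, μ, hμ, h⟩
    have := hfd n
    obtain ⟨K, hK0, hK⟩ := hC.exists_lowerBound_sub hA (F n) (hFC n) h
    refine (EReal.coe_lt_coe_iff.2 hμ).trans_le (le_iInf₂ fun z hz => ?_)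
    refine EReal.coe_le_coe_iff.2 ?_
    by_contra! hlt
    exact hz.2 (hA.mem_discreteSpectrum hK0 hK hlt hz.1)

end IsNonnegSelfAdjoint
end LinearPMap

/-! ### The Friedrichs extension -/

namespace LinearPMap

open Filter Topology

variable {H : Type*} [NormedAddCommGroup H] [InnerProductSpace ℂ H] {T : H →ₗ.[ℂ] H}

/-- The quadratic form of an operator. -/
def form (T : H →ₗ.[ℂ] H) (φ : T.domain) : ℝ := (inner ℂ (T φ) (φ : H)).re

/-- Cauchy sequences with respect to the quadratic form of an operator. -/
def FormCauchy (T : H →ₗ.[ℂ] H) (φ : ℕ → T.domain) : Prop :=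
  ∀ ε > 0, ∃ N, ∀ m ≥ N, ∀ n ≥ N, T.form (φ m - φ n) < ε

theorem form_add_smul (hs : T.IsFormalAdjoint T) (φ ψ : T.domain) (c : ℂ) :
    T.form (φ + c • ψ) = T.form φ + 2 * (c * inner ℂ (T φ) (ψ : H)).re + ‖c‖ ^ 2 * T.form ψ := by
  have h1 : inner ℂ (T ψ) (φ : H) = (starRingEnd ℂ) (inner ℂ (T φ) (ψ : H)) := by
    rw [hs ψ φ, inner_conj_symm]
  have h2 : ‖c‖ ^ 2 = Complex.normSq c := (Complex.normSq_eq_norm_sq c).symm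
  have h3 : (starRingEnd ℂ) c * inner ℂ (T ψ) (φ : H) =
      (starRingEnd ℂ) (c * inner ℂ (T φ) (ψ : H)) := by rw [h1, _root_.map_mul]
  rw [form, LinearPMap.map_add, LinearPMap.map_smul, Submodule.coe_add, Submodule.coe_smul,
    inner_add_left, inner_add_right, inner_add_right, inner_smul_left, inner_smul_left,
    inner_smul_right, inner_smul_right, h3, ← mul_assoc, Complex.conj_mul', h2]
  simp only [Complex.add_re, Complex.conj_re, form, ← Complex.ofReal_pow, Complex.re_ofReal_mul,
    ← h2]
  ring

theorem form_add_add_form_sub (hs : T.IsFormalAdjoint T) (φ ψ : T.domain) :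
    T.form (φ + ψ) + T.form (φ - ψ) = 2 * T.form φ + 2 * T.form ψ := by
  have h1 := form_add_smul hs φ ψ 1
  have h2 := form_add_smul hs φ ψ (-1)
  simp only [one_smul, neg_smul, ← sub_eq_add_neg, norm_neg, norm_one, one_mul, neg_mul,
    Complex.neg_re] at h1 h2
  linarith

theorem form_smul (φ : T.domain) (c : ℂ) : T.form (c • φ) = ‖c‖ ^ 2 * T.form φ := by
  rw [form, LinearPMap.map_smul, Submodule.coe_smul, inner_smul_left, inner_smul_right,
    ← mul_assoc, Complex.conj_mul', ← Complex.ofReal_pow, Complex.re_ofReal_mul, form]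

/-- The Cauchy–Schwarz inequality for a nonnegative form. -/
theorem norm_inner_sq_le_form_mul_form (hs : T.IsFormalAdjoint T) (hn : ∀ φ, 0 ≤ T.form φ)
    (φ ψ : T.domain) : ‖inner ℂ (T φ) (ψ : H)‖ ^ 2 ≤ T.form φ * T.form ψ := by
  obtain ⟨β, hβ⟩ : ∃ β, β = inner ℂ (T φ) (ψ : H) := ⟨_, rfl⟩
  have key : ∀ t : ℝ, 0 ≤ ‖β‖ ^ 2 * T.form ψ * (t * t) + (2 * ‖β‖ ^ 2) * t + T.form φ := by
    intro t
    -- The factor conj β makes the cross term real, so the form is a nonnegative real quadratic in t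
    -- and its discriminant is at most zero.
    have h := hn (φ + ((t : ℂ) * (starRingEnd ℂ) β) • ψ)
    rw [form_add_smul hs, ← hβ, mul_assoc, Complex.conj_mul', ← Complex.ofReal_pow,
      ← Complex.ofReal_mul, Complex.ofReal_re, norm_mul, Complex.norm_real, mul_pow,
      Complex.norm_conj, Real.norm_eq_abs, sq_abs] at h
    linarith
  have h := discrim_le_zero key
  rw [discrim] at h
  rw [← hβ]
  rcases (sq_nonneg ‖β‖).eq_or_lt with h0 | h0
  · rw [← h0]
    exact mul_nonneg (hn _) (hn _)
  · by_contra! h1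
    nlinarith [mul_lt_mul_of_pos_left h1 h0]

theorem FormCauchy.exists_form_le (hs : T.IsFormalAdjoint T) (hn : ∀ φ, 0 ≤ T.form φ)
    {φ : ℕ → T.domain} (hφ : T.FormCauchy φ) : ∃ B N, ∀ n ≥ N, T.form (φ n) ≤ B := by
  obtain ⟨N, hN⟩ := hφ 1 one_pos
  refine ⟨2 * T.form (φ N) + 2, N, fun n hn' => ?_⟩
  have h1 := form_add_add_form_sub hs (φ n - φ N) (φ N)
  have h2 := hN n hn' N le_rfl
  have h3 := hn (φ n - φ N - φ N)
  rw [sub_add_cancel] at h1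
  linarith

/-- With y playing the role of the adjoint applied to u, the difference ⟨Tφₙ, ψₙ⟩ - ⟨y, ψₙ⟩ is the
limit over m of ⟨T(φₙ - φₘ), ψₙ⟩. Cauchy–Schwarz for the form makes it small uniformly in m. Hence
the form, extended by limits, agrees with the adjoint pairing. -/
theorem tendsto_inner_of_formCauchy (hs : T.IsFormalAdjoint T) (hn : ∀ φ, 0 ≤ T.form φ)
    {φ ψ : ℕ → T.domain} (hφ : T.FormCauchy φ) (hψ : T.FormCauchy ψ) {u w y : H}
    (hu : Tendsto (fun n => (φ n : H)) atTop (𝓝 u)) (hw : Tendsto (fun n => (ψ n : H)) atTop (𝓝 w))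
    (hy : ∀ x : T.domain, inner ℂ y (x : H) = inner ℂ u (T x)) :
    Tendsto (fun n => inner ℂ (T (φ n)) (ψ n : H)) atTop (𝓝 (inner ℂ y w)) := by
  have h1 : Tendsto (fun n => inner ℂ y (ψ n : H)) atTop (𝓝 (inner ℂ y w)) :=
    tendsto_const_nhds.inner hw
  have h2 : Tendsto (fun n => inner ℂ (T (φ n)) (ψ n : H) - inner ℂ y (ψ n : H)) atTop (𝓝 0) := by
    rw [Metric.tendsto_atTop]
    intro ε hε
    obtain ⟨B, N, hB⟩ := hψ.exists_form_le hs hn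
    have hB0 : 0 ≤ B := (hn _).trans (hB N le_rfl)
    obtain ⟨N', hN'⟩ := hφ ((ε / 2) ^ 2 / (B + 1)) (by positivity)
    refine ⟨max N N', fun n hn' => ?_⟩
    have h3 : ∀ᶠ m in atTop,
        ‖inner ℂ (T (φ n)) (ψ n : H) - inner ℂ (φ m : H) (T (ψ n))‖ ≤ ε / 2 := by
      filter_upwards [eventually_ge_atTop N'] with m hm
      rw [← hs (φ m) (ψ n), ← inner_sub_left, ← LinearPMap.map_sub]
      have h4 := norm_inner_sq_le_form_mul_form hs hn (φ n - φ m) (ψ n)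
      have h5 := hN' n ((le_max_right _ _).trans hn') m hm
      have h6 := hB n ((le_max_left _ _).trans hn')
      refine le_of_sq_le_sq ?_ (by positivity)
      calc _ ≤ T.form (φ n - φ m) * T.form (ψ n) := h4
        _ ≤ ((ε / 2) ^ 2 / (B + 1)) * (B + 1) :=
          mul_le_mul h5.le (by linarith) (hn _) (by positivity)
        _ = (ε / 2) ^ 2 := by field_simp
    have h7 : Tendsto (fun m => ‖inner ℂ (T (φ n)) (ψ n : H) - inner ℂ (φ m : H) (T (ψ n))‖) atTop
        (𝓝 ‖inner ℂ (T (φ n)) (ψ n : H) - inner ℂ u (T (ψ n))‖) :=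
      (tendsto_const_nhds.sub (hu.inner tendsto_const_nhds)).norm
    rw [dist_zero_right, hy]
    exact (le_of_tendsto h7 h3).trans_lt (half_lt_self hε)
  have h3 := h2.add h1
  simpa using h3

/-- The variational solution of `(T + 1) u = v` in the form domain. -/
theorem exists_weak_solution [CompleteSpace H] (hs : T.IsFormalAdjoint T) (hn : ∀ φ, 0 ≤ T.form φ)
    (v : H) :
    ∃ (u : H) (φ : ℕ → T.domain), Tendsto (fun n => (φ n : H)) atTop (𝓝 u) ∧ T.FormCauchy φ ∧
      ∀ x : T.domain, inner ℂ (v - u) (x : H) = inner ℂ u (T x) := by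
  -- The Dirichlet principle: a minimizing sequence of J is Cauchy in norm and in form by the
  -- parallelogram law, and vanishing of the first variation in the limit is the weak equation.
  let J : T.domain → ℝ := fun φ => T.form φ + ‖(φ : H)‖ ^ 2 - 2 * (inner ℂ v (φ : H)).re
  have hJ : ∀ φ, J φ = T.form φ + ‖(φ : H)‖ ^ 2 - 2 * (inner ℂ v (φ : H)).re := fun _ => rfl
  have hre : ∀ x : H, (inner ℂ x x).re = ‖x‖ ^ 2 := fun x => by
    rw [inner_self_eq_ofReal, Complex.ofReal_re]
  have hbdd : BddBelow (Set.range J) := by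
    refine ⟨-‖v‖ ^ 2, ?_⟩
    rintro _ ⟨φ, rfl⟩
    have h1 := (Complex.re_le_norm _).trans (norm_inner_le_norm (𝕜 := ℂ) v (φ : H))
    rw [hJ]
    nlinarith [hn φ, sq_nonneg (‖v‖ - ‖(φ : H)‖)]
  obtain ⟨j, hj⟩ : ∃ j, j = sInf (Set.range J) := ⟨_, rfl⟩
  have hj1 : ∀ φ, j ≤ J φ := fun φ => hj ▸ csInf_le hbdd ⟨φ, rfl⟩
  have hj2 : ∀ n : ℕ, ∃ φ, J φ < j + 1 / ((n : ℝ) + 1) := fun n => by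
    obtain ⟨_, ⟨φ, rfl⟩, h⟩ := exists_lt_of_csInf_lt (Set.range_nonempty J)
      (show sInf (Set.range J) < j + 1 / ((n : ℝ) + 1) by
        rw [← hj]; exact lt_add_of_pos_right _ (by positivity))
    exact ⟨φ, h⟩
  choose φ hφ using hj2
  have hpar : ∀ m n, T.form (φ m - φ n) + ‖((φ m - φ n : T.domain) : H)‖ ^ 2 ≤
      2 * (1 / ((m : ℝ) + 1)) + 2 * (1 / ((n : ℝ) + 1)) := by
    intro m n
    have h1 := form_add_add_form_sub hs (φ m) (φ n)
    have h2 := parallelogram_law_with_norm ℂ (φ m : H) (φ n)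
    have h3 := hj1 ((1 / 2 : ℂ) • (φ m + φ n))
    rw [hJ, form_smul, Submodule.coe_smul, norm_smul, inner_smul_right, Submodule.coe_add,
      inner_add_right] at h3
    have e1 : ((1 / 2 : ℂ) * (inner ℂ v (φ m : H) + inner ℂ v (φ n : H))).re =
        1 / 2 * ((inner ℂ v (φ m : H)).re + (inner ℂ v (φ n : H)).re) := by
      rw [show (1 / 2 : ℂ) = ((1 / 2 : ℝ) : ℂ) by push_cast; rfl, Complex.re_ofReal_mul,
        Complex.add_re]
    rw [e1, show ‖(1 / 2 : ℂ)‖ = 1 / 2 by simp] at h3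
    have h4 := hφ m
    have h5 := hφ n
    rw [hJ] at h4 h5
    rw [Submodule.coe_sub]
    nlinarith
  have hsmall : ∀ ε > 0, ∃ N, ∀ m ≥ N, ∀ n ≥ N,
      T.form (φ m - φ n) + ‖((φ m - φ n : T.domain) : H)‖ ^ 2 < ε := by
    intro ε hε
    obtain ⟨N, hN⟩ := eventually_atTop.1
      ((tendsto_one_div_add_atTop_nhds_zero_nat (𝕜 := ℝ)).eventually_lt_const
        (show (0 : ℝ) < ε / 4 by positivity))
    refine ⟨N, fun m hm n hn' => (hpar m n).trans_lt ?_⟩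
    linarith [hN m hm, hN n hn']
  have hcau : CauchySeq fun n => (φ n : H) := by
    rw [Metric.cauchySeq_iff]
    intro ε hε
    obtain ⟨N, hN⟩ := hsmall (ε ^ 2) (by positivity)
    refine ⟨N, fun m hm n hn' => ?_⟩
    have h1 := hN m hm n hn'
    have h2 := hn (φ m - φ n)
    rw [dist_eq_norm, ← Submodule.coe_sub]
    exact lt_of_pow_lt_pow_left₀ 2 hε.le (by linarith)
  obtain ⟨u, hu⟩ := cauchySeq_tendsto_of_complete hcau
  refine ⟨u, φ, hu, fun ε hε => ?_, fun x => ?_⟩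
  · obtain ⟨N, hN⟩ := hsmall ε hε
    exact ⟨N, fun m hm n hn' => by
      have := hN m hm n hn'
      nlinarith [sq_nonneg ‖((φ m - φ n : T.domain) : H)‖]⟩
  · obtain ⟨D, hD⟩ : ∃ D, D = T.form x + ‖(x : H)‖ ^ 2 + 1 := ⟨_, rfl⟩
    have hD0 : 0 < D := by have := hn x; rw [hD]; positivity
    have hβ : ∀ n, ‖inner ℂ (T (φ n) + φ n - v) (x : H)‖ ^ 2 ≤ 1 / ((n : ℝ) + 1) * D := by
      intro n
      obtain ⟨β, hβ⟩ : ∃ β, β = inner ℂ (T (φ n) + φ n - v) (x : H) := ⟨_, rfl⟩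
      -- Compare with the minimum after a step against the first variation β. Near-minimality within
      -- 1/(n + 1) then forces ‖β‖² ≤ D/(n + 1).
      have h1 := hj1 (φ n + (-((D⁻¹ : ℝ) : ℂ) * (starRingEnd ℂ) β) • x)
      obtain ⟨c, hc⟩ : ∃ c, c = -((D⁻¹ : ℝ) : ℂ) * (starRingEnd ℂ) β := ⟨_, rfl⟩
      have hcn : ‖c‖ ^ 2 = D⁻¹ ^ 2 * ‖β‖ ^ 2 := by
        rw [hc, norm_mul, norm_neg, Complex.norm_real, Complex.norm_conj, mul_pow,
          Real.norm_eq_abs, sq_abs]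
      have hcβ : (c * β).re = -(D⁻¹ * ‖β‖ ^ 2) := by
        rw [hc, mul_assoc, Complex.conj_mul', neg_mul, ← Complex.ofReal_pow, ← Complex.ofReal_mul,
          Complex.neg_re, Complex.ofReal_re]
      have hsq : ‖((φ n : H) + c • (x : H))‖ ^ 2 = ‖(φ n : H)‖ ^ 2 +
          2 * (c * inner ℂ (φ n : H) (x : H)).re + ‖c‖ ^ 2 * ‖(x : H)‖ ^ 2 := by
        rw [norm_add_sq (𝕜 := ℂ), inner_smul_right, norm_smul, mul_pow]
        rfl
      rw [← hc, hJ, form_add_smul hs, Submodule.coe_add, Submodule.coe_smul, hsq,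
        inner_add_right, inner_smul_right, Complex.add_re] at h1
      have h2 := hφ n
      rw [hJ] at h2
      have h3 : (c * β).re = (c * inner ℂ (T (φ n)) (x : H)).re +
          (c * inner ℂ (φ n : H) (x : H)).re - (c * inner ℂ v (x : H)).re := by
        rw [hβ, inner_sub_left, inner_add_left, mul_sub, mul_add, Complex.sub_re, Complex.add_re]
      have h4 : 0 ≤ 1 / ((n : ℝ) + 1) + 2 * (c * β).re + ‖c‖ ^ 2 * (D - 1) := by
        rw [hD, h3]
        linarith
      have h5 : ‖c‖ ^ 2 * (D - 1) ≤ D⁻¹ * ‖β‖ ^ 2 := by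
        calc ‖c‖ ^ 2 * (D - 1) ≤ ‖c‖ ^ 2 * D := by gcongr; linarith
          _ = D⁻¹ * ‖β‖ ^ 2 := by rw [hcn]; field_simp
      rw [← hβ]
      rw [hcβ] at h4
      have h6 : D⁻¹ * ‖β‖ ^ 2 ≤ 1 / ((n : ℝ) + 1) := by linarith
      rwa [inv_mul_le_iff₀ hD0, mul_comm D] at h6
    have hlim0 : Tendsto (fun n => inner ℂ (T (φ n) + φ n - v) (x : H)) atTop (𝓝 0) := by
      have h1 : Tendsto (fun n : ℕ => 1 / ((n : ℝ) + 1) * D) atTop (𝓝 (0 * D)) :=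
        tendsto_one_div_add_atTop_nhds_zero_nat.mul_const D
      rw [zero_mul] at h1
      have h2 := squeeze_zero (fun n => sq_nonneg _) hβ h1
      have h3 := h2.sqrt
      simp only [Real.sqrt_sq (norm_nonneg _), Real.sqrt_zero] at h3
      exact tendsto_zero_iff_norm_tendsto_zero.2 h3
    have hlim1 : Tendsto (fun n => inner ℂ (T (φ n) + φ n - v) (x : H)) atTop
        (𝓝 (inner ℂ u (T x) + inner ℂ u (x : H) - inner ℂ v (x : H))) := by
      simp only [inner_sub_left, inner_add_left, hs _ x]
      exact ((hu.inner tendsto_const_nhds).add (hu.inner tendsto_const_nhds)).sub_const _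
    have h := tendsto_nhds_unique hlim0 hlim1
    rw [inner_sub_left]
    linear_combination h

theorem inner_domRestrict_adjoint [CompleteSpace H] (hd : Dense (T.domain : Set H))
    {W : Submodule ℂ H} (u : (T.adjoint.domRestrict W).domain) (x : T.domain) :
    inner ℂ (T.adjoint.domRestrict W u) (x : H) = inner ℂ (u : H) (T x) :=
  (T.adjoint_isFormalAdjoint hd) ⟨u, u.2.2⟩ x

theorem le_domRestrict_adjoint [CompleteSpace H] (hd : Dense (T.domain : Set H))
    (hs : T.IsFormalAdjoint T) {W : Submodule ℂ H} (hW : T.domain ≤ W) :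
    T ≤ T.adjoint.domRestrict W := by
  have h := hs.le_adjoint hd
  refine ⟨fun x hx => ⟨hW hx, h.1 hx⟩, fun x y hxy => ?_⟩
  exact h.2 (x := x) (y := ⟨y, y.2.2⟩) hxy

/-- The Friedrichs extension of a nonnegative symmetric operator, i.e. the restriction of the
adjoint to the form domain `W`, is nonnegative and self-adjoint, and the original domain is a form core. -/
theorem isNonnegSelfAdjoint_domRestrict_adjoint [CompleteSpace H] (hd : Dense (T.domain : Set H))
    (hs : T.IsFormalAdjoint T) (hn : ∀ φ, 0 ≤ T.form φ) {W : Submodule ℂ H}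
    (hW : ∀ f, f ∈ W ↔ ∃ φ : ℕ → T.domain,
      Tendsto (fun n => (φ n : H)) atTop (𝓝 f) ∧ T.FormCauchy φ) :
    (T.adjoint.domRestrict W).IsNonnegSelfAdjoint ∧
      (T.adjoint.domRestrict W).IsFormCore T.domain := by
  have hle : T.domain ≤ W := fun x hx => (hW x).2 ⟨fun _ => ⟨x, hx⟩, tendsto_const_nhds,
    fun ε hε => ⟨0, fun _ _ _ _ => by
      simpa only [sub_self, form, Submodule.coe_zero, inner_zero_right, Complex.zero_re]⟩⟩
  have hext := le_domRestrict_adjoint hd hs hle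
  have hlim := fun (u : (T.adjoint.domRestrict W).domain) {φ ψ : ℕ → T.domain} {w : H}
    (hφ : T.FormCauchy φ) (hψ : T.FormCauchy ψ)
    (hu : Tendsto (fun n => (φ n : H)) atTop (𝓝 (u : H)))
    (hw : Tendsto (fun n => (ψ n : H)) atTop (𝓝 w)) =>
    tendsto_inner_of_formCauchy hs hn hφ hψ hu hw (inner_domRestrict_adjoint hd u)
  refine ⟨⟨fun u w => ?_, fun u => ?_, fun v => ?_⟩, hext.1, fun u => ?_⟩
  · obtain ⟨φ, h1, h2⟩ := (hW u).1 u.2.1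
    obtain ⟨ψ, h3, h4⟩ := (hW w).1 w.2.1
    have h5 := hlim u h2 h4 h1 h3
    have h6 := (Complex.continuous_conj.tendsto _).comp (hlim w h4 h2 h3 h1)
    refine tendsto_nhds_unique h5 ?_
    rw [inner_conj_symm] at h6
    refine h6.congr fun n => ?_
    rw [Function.comp_apply, inner_conj_symm, hs]
  · obtain ⟨φ, h1, h2⟩ := (hW u).1 u.2.1
    exact ge_of_tendsto' ((Complex.continuous_re.tendsto _).comp (hlim u h2 h2 h1 h1))
      fun n => hn (φ n)
  · obtain ⟨u, φ, h1, h2, h3⟩ := exists_weak_solution hs hn v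
    have hu : u ∈ T.adjoint.domain := T.mem_adjoint_domain_of_exists u ⟨v - u, h3⟩
    refine ⟨⟨u, (hW u).2 ⟨φ, h1, h2⟩, hu⟩, ?_⟩
    have h4 : T.adjoint.domRestrict W ⟨u, (hW u).2 ⟨φ, h1, h2⟩, hu⟩ = T.adjoint ⟨u, hu⟩ := rfl
    rw [h4, T.adjoint_apply_eq hd ⟨u, hu⟩ h3, sub_add_cancel]
  · obtain ⟨φ, h1, h2⟩ := (hW u).1 u.2.1
    refine ⟨fun n => ⟨φ n, hext.1 (φ n).2⟩, fun n => (φ n).2, h1, ?_⟩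
    refine ((Complex.continuous_re.tendsto _).comp (hlim u h2 h2 h1 h1)).congr fun n => ?_
    rw [Function.comp_apply, hext.2 (x := φ n) (y := ⟨φ n, hext.1 (φ n).2⟩) rfl]

end LinearPMap

/-! ### The Laplacian of a weighted graph -/

namespace WeightedGraph

open Filter Topology

/-! ### Green's formula and lower semicontinuity of the energy -/

section Green

variable {V : Type*} (G : WeightedGraph V)

open Classical in
/-- A finite set of vertices together with its neighbours. -/
def closedNhd (t : Finset V) : Finset V := t ∪ t.biUnion G.neighbors

theorem subset_closedNhd (t : Finset V) : t ⊆ G.closedNhd t := by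
  classical
  exact Finset.subset_union_left

theorem E_eq_zero_of_notMem {x y : V} (h : y ∉ G.neighbors x) : G.E x y = 0 :=
  le_antisymm (not_lt.1 fun h' => h (G.mem_neighbors.2 h')) (G.E_nonneg x y)

theorem E_eq_zero_of_notMem_closedNhd {t : Finset V} {x y : V} (hx : x ∈ t)
    (hy : y ∉ G.closedNhd t) : G.E x y = 0 := by
  classical
  refine G.E_eq_zero_of_notMem fun h => hy ?_
  exact Finset.mem_union_right _ (Finset.mem_biUnion.2 ⟨x, hx, h⟩)

theorem mul_algLaplacian (f : V → ℂ) {x : V} {s : Finset V} (hs : ∀ y ∉ s, G.E x y = 0) :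
    (G.m x : ℂ) * G.algLaplacian f x = ∑ y ∈ s, (G.E x y : ℂ) * (f x - f y) := by
  rw [algLaplacian, ← mul_assoc, mul_one_div_cancel (by exact_mod_cast (G.m_pos x).ne'), one_mul]
  classical
  refine Finset.sum_subset_zero_on_sdiff (fun y hy => ?_) (fun y hy => ?_) fun _ _ => rfl
  · by_contra h
    exact (G.mem_neighbors.1 hy).ne' (hs y h)
  · rw [G.E_eq_zero_of_notMem (Finset.mem_sdiff.1 hy).2, Complex.ofReal_zero, zero_mul]

/-- Green's formula. -/
theorem sum_algLaplacian_mul (f g : V → ℂ) {t : Finset V} (hg : ∀ x ∉ t, g x = 0) :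
    ∑ x ∈ t, (G.m x : ℂ) * ((starRingEnd ℂ) (G.algLaplacian f x) * g x) =
      (1 / 2) * ∑ x ∈ G.closedNhd t, ∑ y ∈ G.closedNhd t,
        (G.E x y : ℂ) * ((starRingEnd ℂ) (f x - f y) * (g x - g y)) := by
  classical
  have h1 : ∑ x ∈ t, (G.m x : ℂ) * ((starRingEnd ℂ) (G.algLaplacian f x) * g x) =
      ∑ x ∈ G.closedNhd t, ∑ y ∈ G.closedNhd t,
        (G.E x y : ℂ) * ((starRingEnd ℂ) (f x - f y) * g x) := by
    refine Finset.sum_subset_zero_on_sdiff (G.subset_closedNhd t) (fun x hx => ?_) fun x hx => ?_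
    · rw [hg x (Finset.mem_sdiff.1 hx).2]
      simp
    · have := congrArg (starRingEnd ℂ)
        (G.mul_algLaplacian f fun y hy => G.E_eq_zero_of_notMem_closedNhd hx hy)
      rw [map_mul, Complex.conj_ofReal, map_sum] at this
      rw [← mul_assoc, this, Finset.sum_mul]
      refine Finset.sum_congr rfl fun y _ => ?_
      rw [map_mul, Complex.conj_ofReal, mul_assoc]
  have h2 : ∑ x ∈ G.closedNhd t, ∑ y ∈ G.closedNhd t,
        (G.E x y : ℂ) * ((starRingEnd ℂ) (f x - f y) * g x) =
      ∑ x ∈ G.closedNhd t, ∑ y ∈ G.closedNhd t,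
        (G.E x y : ℂ) * ((starRingEnd ℂ) (f x - f y) * (-g y)) := by
    rw [Finset.sum_comm]
    refine Finset.sum_congr rfl fun y _ => Finset.sum_congr rfl fun x _ => ?_
    rw [G.E_symm, ← neg_sub (f y), map_neg]
    ring
  have h3 : ∑ x ∈ G.closedNhd t, ∑ y ∈ G.closedNhd t,
        (G.E x y : ℂ) * ((starRingEnd ℂ) (f x - f y) * (g x - g y)) =
      ∑ x ∈ G.closedNhd t, ∑ y ∈ G.closedNhd t,
        (G.E x y : ℂ) * ((starRingEnd ℂ) (f x - f y) * g x) +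
      ∑ x ∈ G.closedNhd t, ∑ y ∈ G.closedNhd t,
        (G.E x y : ℂ) * ((starRingEnd ℂ) (f x - f y) * (-g y)) := by
    simp only [← Finset.sum_add_distrib]
    refine Finset.sum_congr rfl fun x _ => Finset.sum_congr rfl fun y _ => ?_
    ring
  rw [h1, h3, ← h2]
  ring

theorem sum_re_algLaplacian_mul_self (f : V → ℂ) {t : Finset V} (hf : ∀ x ∉ t, f x = 0) :
    ∑ x ∈ t, G.m x * ((starRingEnd ℂ) (G.algLaplacian f x) * f x).re =
      (1 / 2) * ∑ x ∈ G.closedNhd t, ∑ y ∈ G.closedNhd t, G.E x y * ‖f x - f y‖ ^ 2 := by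
  have h := congrArg Complex.re (G.sum_algLaplacian_mul f f hf)
  rw [show (1 / 2 : ℂ) = ((1 / 2 : ℝ) : ℂ) by push_cast; rfl] at h
  simp only [Complex.re_sum, Complex.re_ofReal_mul, Complex.conj_mul', ← Complex.ofReal_pow,
    Complex.ofReal_re] at h
  exact h

theorem energy_eq_of_support (f : V → ℂ) {t : Finset V} (hf : ∀ x ∉ t, f x = 0) :
    G.energy f =
      ENNReal.ofReal (∑ x ∈ t, G.m x * ((starRingEnd ℂ) (G.algLaplacian f x) * f x).re) := by
  have h0 : ∀ x y, 0 ≤ G.E x y * ‖f x - f y‖ ^ 2 := fun x y =>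
    mul_nonneg (G.E_nonneg x y) (sq_nonneg _)
  have h1 : ∀ x y, x ∉ G.closedNhd t → G.E x y * ‖f x - f y‖ ^ 2 = 0 := fun x y hx => by
    by_cases hy : y ∈ t
    · rw [G.E_symm, G.E_eq_zero_of_notMem_closedNhd hy hx, zero_mul]
    · rw [hf x fun h => hx (G.subset_closedNhd t h), hf y hy, sub_zero, norm_zero]
      ring
  have h2 : ∀ x y, y ∉ G.closedNhd t → G.E x y * ‖f x - f y‖ ^ 2 = 0 := fun x y hy => by
    rw [G.E_symm, norm_sub_rev, h1 y x hy]
  rw [sum_re_algLaplacian_mul_self _ _ hf, ENNReal.ofReal_mul (by norm_num), energy,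
    ENNReal.ofReal_sum_of_nonneg fun x _ => Finset.sum_nonneg fun y _ => h0 x y]
  congr 1
  · rw [ENNReal.ofReal_div_of_pos two_pos]
    simp
  · rw [tsum_eq_sum (s := G.closedNhd t) fun x hx => by simp [h1 x _ hx]]
    refine Finset.sum_congr rfl fun x _ => ?_
    rw [ENNReal.ofReal_sum_of_nonneg fun y _ => h0 x y,
      tsum_eq_sum (s := G.closedNhd t) fun y hy => by simp [h2 x y hy]]

/-- Fatou's lemma for the energy: each finite partial sum converges and stays below c. -/
theorem energy_le_of_tendsto {f : ℕ → V → ℂ} {g : V → ℂ} {c : ℝ≥0∞}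
    (h : ∀ x, Tendsto (fun n => f n x) atTop (𝓝 (g x))) (hc : ∀ᶠ n in atTop, G.energy (f n) ≤ c) :
    G.energy g ≤ c := by
  have h1 : ∀ k : V → ℂ, G.energy k =
      ∑' p : V × V, (1 / 2) * ENNReal.ofReal (G.E p.1 p.2 * ‖k p.1 - k p.2‖ ^ 2) := fun k => by
    rw [ENNReal.tsum_mul_left, energy,
      ENNReal.tsum_prod (f := fun x y => ENNReal.ofReal (G.E x y * ‖k x - k y‖ ^ 2))]
  rw [h1]
  refine ENNReal.summable.tsum_le_of_sum_le fun s => ?_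
  have h2 : Tendsto (fun n => ∑ p ∈ s,
      (1 / 2) * ENNReal.ofReal (G.E p.1 p.2 * ‖f n p.1 - f n p.2‖ ^ 2)) atTop
      (𝓝 (∑ p ∈ s, (1 / 2) * ENNReal.ofReal (G.E p.1 p.2 * ‖g p.1 - g p.2‖ ^ 2))) :=
    tendsto_finsetSum _ fun p _ => ENNReal.Tendsto.const_mul (ENNReal.tendsto_ofReal
      ((((h p.1).sub (h p.2)).norm.pow 2).const_mul _)) (Or.inr (by simp))
  refine le_of_tendsto h2 (hc.mono fun n hn => ?_)
  rw [h1] at hn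
  exact (ENNReal.sum_le_tsum s).trans hn

/-- The form of the Laplacian is at least `μ` on the finitely supported functions vanishing on the
finite set `B`. -/
def HasLowerBoundOff (B : Finset V) (μ : ℝ) : Prop :=
  ∀ (t : Finset V) (f : V → ℂ), (∀ x ∉ t, f x = 0) → (∀ x ∈ B, f x = 0) →
    μ * ∑ x ∈ t, G.m x * ‖f x‖ ^ 2 ≤
      ∑ x ∈ t, G.m x * ((starRingEnd ℂ) (G.algLaplacian f x) * f x).re

end Green

/-! ### From the Hilbert space to finite sums over vertices -/

section Lp

variable {V : Type*} [MeasurableSpace V] [DiscreteMeasurableSpace V] (G : WeightedGraph V)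

theorem measure_real_singleton (x : V) : G.measure.real {x} = G.m x := by
  rw [Measure.real, measure_singleton, ENNReal.toReal_ofReal (G.m_pos x).le]

theorem inner_eq_sum (f g : G.L2) {t : Finset V} (h : ∀ x ∉ t, f x = 0 ∨ g x = 0) :
    inner ℂ f g = ∑ x ∈ t, (G.m x : ℂ) * ((starRingEnd ℂ) (f x) * g x) := by
  rw [L2.inner_def, ← setIntegral_eq_integral_of_forall_compl_eq_zero (s := (t : Set V)),
    setIntegral_finset]
  · refine Finset.sum_congr rfl fun x _ => ?_
    rw [measure_real_singleton, RCLike.inner_apply, Complex.real_smul, mul_comm (g x)]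
  · exact (L2.integrable_inner f g).integrableOn
  · intro x hx
    rcases h x (by simpa using hx) with h | h <;> simp [h]

theorem norm_sq_eq_sum (f : G.L2) {t : Finset V} (h : ∀ x ∉ t, f x = 0) :
    ‖f‖ ^ 2 = ∑ x ∈ t, G.m x * ‖f x‖ ^ 2 := by
  have h1 := LinearPMap.inner_self_eq_ofReal f
  rw [G.inner_eq_sum f f fun x hx => Or.inl (h x hx)] at h1
  have h2 := congrArg Complex.re h1
  simp only [Complex.re_sum, Complex.re_ofReal_mul, Complex.conj_mul', ← Complex.ofReal_pow,
    Complex.ofReal_re] at h2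
  exact h2.symm

theorem coeFn_toLp {f : V → ℂ} (hf : MemLp f 2 G.measure) : (⇑(hf.toLp f) : V → ℂ) = f :=
  funext (G.ae_iff_forall.1 hf.coeFn_toLp)

theorem ext_of_forall {f g : G.L2} (h : ∀ x, f x = g x) : f = g :=
  Lp.ext (G.ae_iff_forall.2 h)

open Classical in
/-- The function that is `1` at `x` and `0` elsewhere. -/
def delta (x : V) : G.L2 :=
  MemLp.toLp (Pi.single x 1) (G.memLp_of_finite_support
    ((Set.finite_singleton x).subset (Pi.support_single_subset (a := (1 : ℂ)))))

open Classical in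
theorem delta_apply (x y : V) : G.delta x y = if y = x then 1 else 0 := by
  rw [delta, coeFn_toLp, Pi.single_apply]

theorem inner_delta (x : V) (f : G.L2) : inner ℂ (G.delta x) f = (G.m x : ℂ) * f x := by
  rw [G.inner_eq_sum (t := {x})]
  · simp [delta_apply]
  · intro y hy
    left
    rw [delta_apply, if_neg (by simpa using hy)]

theorem tendsto_apply {f : ℕ → G.L2} {g : G.L2} (h : Tendsto f atTop (𝓝 g)) (x : V) :
    Tendsto (fun n => f n x) atTop (𝓝 (g x)) := by
  have h1 : Tendsto (fun n => inner ℂ (G.delta x) (f n)) atTop (𝓝 (inner ℂ (G.delta x) g)) :=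
    tendsto_const_nhds.inner h
  simp only [inner_delta] at h1
  have hm : (G.m x : ℂ) ≠ 0 := by exact_mod_cast (G.m_pos x).ne'
  have h2 := h1.const_mul (G.m x : ℂ)⁻¹
  simpa only [inv_mul_cancel_left₀ hm] using h2

theorem delta_mem_finSupp (x : V) : G.delta x ∈ G.finSupp := by
  refine (Set.finite_singleton x).subset fun y hy => ?_
  by_contra h
  exact hy (by rw [delta_apply, if_neg (by simpa using h)])

theorem dense_finSupp : Dense (G.finSupp : Set G.L2) := by
  rw [Submodule.dense_iff_topologicalClosure_eq_top, Submodule.topologicalClosure_eq_top_iff,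
    Submodule.eq_bot_iff]
  intro f hf
  refine G.ext_of_forall fun x => ?_
  have h := (Submodule.mem_orthogonal _ _).1 hf _ (G.delta_mem_finSupp x)
  rw [inner_delta] at h
  rw [coeFn_zero, Pi.zero_apply]
  exact (mul_eq_zero.1 h).resolve_left (by exact_mod_cast (G.m_pos x).ne')

theorem minLaplacian_apply (φ : G.minLaplacian.domain) (x : V) :
    G.minLaplacian φ x = G.algLaplacian (φ : G.L2) x :=
  congrFun (G.coeFn_toLp (G.memLp_of_finite_support (G.support_algLaplacian_finite φ.2))) x

/-- The support of a finitely supported function, as a finite set. -/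
def supp (φ : G.minLaplacian.domain) : Finset V := Set.Finite.toFinset φ.2

theorem eq_zero_of_notMem_supp (φ : G.minLaplacian.domain) {x : V} (hx : x ∉ G.supp φ) :
    (φ : G.L2) x = 0 := by
  by_contra h
  exact hx ((Set.Finite.mem_toFinset φ.2).2 h)

theorem inner_minLaplacian (φ : G.minLaplacian.domain) (g : G.L2) {t : Finset V}
    (hg : ∀ x ∉ t, g x = 0) : inner ℂ (G.minLaplacian φ) g =
      ∑ x ∈ t, (G.m x : ℂ) * ((starRingEnd ℂ) (G.algLaplacian (φ : G.L2) x) * g x) := by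
  rw [G.inner_eq_sum _ g fun x hx => Or.inr (hg x hx)]
  simp only [minLaplacian_apply]

theorem form_minLaplacian (φ : G.minLaplacian.domain) {t : Finset V}
    (h : ∀ x ∉ t, (φ : G.L2) x = 0) : G.minLaplacian.form φ =
      ∑ x ∈ t, G.m x * ((starRingEnd ℂ) (G.algLaplacian (φ : G.L2) x) * (φ : G.L2) x).re := by
  rw [LinearPMap.form, G.inner_minLaplacian φ _ h, Complex.re_sum]
  simp only [Complex.re_ofReal_mul]

theorem minLaplacian_isFormalAdjoint : G.minLaplacian.IsFormalAdjoint G.minLaplacian := by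
  classical
  intro φ ψ
  have h1 : ∀ x ∉ G.supp φ ∪ G.supp ψ, (φ : G.L2) x = 0 := fun x hx =>
    G.eq_zero_of_notMem_supp φ fun h => hx (Finset.mem_union_left _ h)
  have h2 : ∀ x ∉ G.supp φ ∪ G.supp ψ, (ψ : G.L2) x = 0 := fun x hx =>
    G.eq_zero_of_notMem_supp ψ fun h => hx (Finset.mem_union_right _ h)
  rw [← inner_conj_symm (φ : G.L2), G.inner_minLaplacian φ _ h2, G.inner_minLaplacian ψ _ h1,
    sum_algLaplacian_mul _ _ _ h1, sum_algLaplacian_mul _ _ _ h2]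
  simp only [map_mul, map_sum, Complex.conj_ofReal, Complex.conj_conj, map_div₀, map_one,
    map_ofNat]
  congr 1
  refine Finset.sum_congr rfl fun x _ => Finset.sum_congr rfl fun y _ => ?_
  ring

theorem form_minLaplacian_nonneg (φ : G.minLaplacian.domain) : 0 ≤ G.minLaplacian.form φ := by
  rw [G.form_minLaplacian φ fun x => G.eq_zero_of_notMem_supp φ, sum_re_algLaplacian_mul_self _ _
    fun x => G.eq_zero_of_notMem_supp φ]
  exact mul_nonneg (by norm_num) (Finset.sum_nonneg fun x _ => Finset.sum_nonneg fun y _ =>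
    mul_nonneg (G.E_nonneg x y) (sq_nonneg _))

theorem energy_eq_form (φ : G.minLaplacian.domain) :
    G.energy (φ : G.L2) = ENNReal.ofReal (G.minLaplacian.form φ) := by
  rw [G.form_minLaplacian φ fun x => G.eq_zero_of_notMem_supp φ,
    G.energy_eq_of_support _ fun x => G.eq_zero_of_notMem_supp φ]

/-- This matches the closure in the energy norm with the abstract Friedrichs construction.
Convergence in energy implies form-Cauchy by the quasi-triangle inequality; conversely, Fatou in m
bounds the energy of f - φₙ by those of φₘ - φₙ. -/
theorem mem_formDomain_iff (f : G.L2) : f ∈ G.formDomain ↔ ∃ φ : ℕ → G.minLaplacian.domain,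
    Tendsto (fun n => (φ n : G.L2)) atTop (𝓝 f) ∧ G.minLaplacian.FormCauchy φ := by
  constructor
  · rintro ⟨φ, h1, h2, h3⟩
    refine ⟨fun n => ⟨φ n, h1 n⟩, ?_, fun ε hε => ?_⟩
    · rw [tendsto_iff_norm_sub_tendsto_zero]
      simpa only [norm_sub_rev] using h2
    · obtain ⟨N, hN⟩ := eventually_atTop.1 (h3.eventually_lt_const
        (show 0 < ENNReal.ofReal (ε / 4) by simpa using hε))
      refine ⟨N, fun m hm n hn => ?_⟩
      rw [← ENNReal.ofReal_lt_ofReal_iff hε, ← energy_eq_form, Submodule.coe_sub]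
      have e1 : (⇑(φ m - φ n) : V → ℂ) = ⇑(f - φ n) + (-1 : ℂ) • ⇑(f - φ m) := by
        rw [← coeFn_smul, ← coeFn_add]
        congr 1
        rw [neg_one_smul]
        abel_nf
      change G.energy (⇑(φ m - φ n) : V → ℂ) < _
      rw [e1]
      refine (G.energy_add_le _ _).trans_lt ?_
      rw [energy_smul, norm_neg, norm_one, one_pow, ENNReal.ofReal_one, one_mul]
      have h4 : ENNReal.ofReal ε = 2 * ENNReal.ofReal (ε / 4) + 2 * ENNReal.ofReal (ε / 4) := by
        rw [show (2 : ℝ≥0∞) = ENNReal.ofReal 2 by simp, ← ENNReal.ofReal_mul (by norm_num),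
          ← ENNReal.ofReal_add (by positivity) (by positivity)]
        congr 1
        ring
      rw [h4]
      exact ENNReal.add_lt_add
        ((ENNReal.mul_lt_mul_iff_right (by simp) (by simp)).2 (hN n hn))
        ((ENNReal.mul_lt_mul_iff_right (by simp) (by simp)).2 (hN m hm))
  · rintro ⟨φ, h1, h2⟩
    refine ⟨fun n => φ n, fun n => (φ n).2, ?_, ?_⟩
    · rw [tendsto_iff_norm_sub_tendsto_zero] at h1
      simpa only [norm_sub_rev] using h1
    · rw [ENNReal.tendsto_atTop_zero]
      intro ε hε
      obtain ⟨δ, hδ0, hδ⟩ : ∃ δ : ℝ, 0 < δ ∧ ENNReal.ofReal δ ≤ ε := by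
        obtain ⟨q, hq1, hq2⟩ := ENNReal.lt_iff_exists_nnreal_btwn.1 hε
        exact ⟨q, by exact_mod_cast hq1, by simpa using hq2.le⟩
      obtain ⟨N, hN⟩ := h2 δ hδ0
      refine ⟨N, fun n hn => ?_⟩
      refine G.energy_le_of_tendsto (f := fun m => ⇑((φ m : G.L2) - φ n))
        (fun x => G.tendsto_apply (h1.sub_const _) x) ?_
      filter_upwards [eventually_ge_atTop N] with m hm
      have := G.energy_eq_form (φ m - φ n)
      rw [Submodule.coe_sub] at this
      rw [this]
      exact (ENNReal.ofReal_le_ofReal (hN m hm n hn).le).trans hδ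

theorem laplacian_isNonnegSelfAdjoint : G.laplacian.IsNonnegSelfAdjoint :=
  (LinearPMap.isNonnegSelfAdjoint_domRestrict_adjoint G.dense_finSupp
    G.minLaplacian_isFormalAdjoint G.form_minLaplacian_nonneg G.mem_formDomain_iff).1

theorem finSupp_isFormCore : G.laplacian.IsFormCore G.finSupp :=
  (LinearPMap.isNonnegSelfAdjoint_domRestrict_adjoint G.dense_finSupp
    G.minLaplacian_isFormalAdjoint G.form_minLaplacian_nonneg G.mem_formDomain_iff).2

theorem minLaplacian_le_laplacian : G.minLaplacian ≤ G.laplacian :=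
  LinearPMap.le_domRestrict_adjoint G.dense_finSupp G.minLaplacian_isFormalAdjoint
    fun _ hx => (G.finSupp_isFormCore.le hx).1

theorem hasLowerBoundOff_iff {B : Finset V} {μ : ℝ} :
    G.HasLowerBoundOff B μ ↔ ∀ φ : G.laplacian.domain, (φ : G.L2) ∈ G.finSupp →
      (∀ x ∈ B, (φ : G.L2) x = 0) →
      μ * ‖(φ : G.L2)‖ ^ 2 ≤ (inner ℂ (G.laplacian φ) (φ : G.L2)).re := by
  have key : ∀ (φ : G.laplacian.domain) (hφ : (φ : G.L2) ∈ G.finSupp),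
      (inner ℂ (G.laplacian φ) (φ : G.L2)).re = G.minLaplacian.form ⟨φ, hφ⟩ := fun φ hφ => by
    rw [LinearPMap.form, G.minLaplacian_le_laplacian.2 (x := ⟨φ, hφ⟩) (y := φ) rfl]
  constructor
  · intro h φ hφ hB
    have h0 : ∀ x ∉ G.supp ⟨φ, hφ⟩, (φ : G.L2) x = 0 :=
      fun x hx => G.eq_zero_of_notMem_supp ⟨φ, hφ⟩ hx
    rw [key φ hφ, G.form_minLaplacian ⟨φ, hφ⟩ h0, G.norm_sq_eq_sum _ h0]
    exact h _ _ h0 hB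
  · intro h t f hf hB
    have hfin : (Function.support f).Finite := t.finite_toSet.subset fun x hx => by
      by_contra hxt
      exact hx (hf x hxt)
    have hco := G.coeFn_toLp (G.memLp_of_finite_support hfin)
    have hmem : (G.memLp_of_finite_support hfin).toLp f ∈ G.finSupp := by
      change (Function.support _).Finite
      rwa [hco]
    have h1 := h ⟨_, G.finSupp_isFormCore.le hmem⟩ hmem (by rwa [hco])
    have h0 : ∀ x ∉ t, ((G.memLp_of_finite_support hfin).toLp f : V → ℂ) x = 0 := by rwa [hco]
    rw [key _ hmem, G.form_minLaplacian ⟨_, hmem⟩ h0, G.norm_sq_eq_sum _ h0] at h1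
    simpa only [hco] using h1

theorem coe_lt_spectralBottom_spectrum_iff {l : ℝ} :
    (l : EReal) < spectralBottom G.laplacian.spectrum ↔ ∃ μ > l, G.HasLowerBoundOff ∅ μ := by
  rw [G.laplacian_isNonnegSelfAdjoint.coe_lt_spectralBottom_spectrum_iff G.finSupp_isFormCore]
  simp [hasLowerBoundOff_iff]

/-- The functions supported in a finite set. -/
def supportedIn (B : Finset V) : Submodule ℂ G.L2 where
  carrier := {f | ∀ x ∉ B, f x = 0}
  add_mem' {f g} hf hg x hx := by rw [coeFn_add, Pi.add_apply, hf x hx, hg x hx, add_zero]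
  zero_mem' x _ := by rw [coeFn_zero, Pi.zero_apply]
  smul_mem' c f hf x hx := by rw [coeFn_smul, Pi.smul_apply, hf x hx, smul_zero]

theorem finiteDimensional_supportedIn (B : Finset V) : FiniteDimensional ℂ (G.supportedIn B) := by
  let P : G.supportedIn B →ₗ[ℂ] (B → ℂ) :=
    { toFun := fun f x => (f : G.L2) x
      map_add' := fun f g => by
        funext x
        rw [Submodule.coe_add, coeFn_add]
        rfl
      map_smul' := fun c f => by
        funext x
        rw [Submodule.coe_smul, coeFn_smul]
        rfl }
  refine FiniteDimensional.of_injective P ((injective_iff_map_eq_zero P).2 fun f hf => ?_)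
  refine Subtype.ext (G.ext_of_forall fun x => ?_)
  rw [Submodule.coe_zero, coeFn_zero, Pi.zero_apply]
  by_cases hx : x ∈ B
  · exact congrFun hf ⟨x, hx⟩
  · exact f.2 x hx

theorem mem_orthogonal_supportedIn {B : Finset V} {f : G.L2} :
    f ∈ (G.supportedIn B)ᗮ ↔ ∀ x ∈ B, f x = 0 := by
  constructor
  · intro h x hx
    have h1 := (Submodule.mem_orthogonal _ _).1 h (G.delta x) fun y hy => by
      rw [delta_apply, if_neg (by rintro rfl; exact hy hx)]
    rw [inner_delta] at h1
    exact (mul_eq_zero.1 h1).resolve_left (by exact_mod_cast (G.m_pos x).ne')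
  · intro h
    refine (Submodule.mem_orthogonal _ _).2 fun g hg => ?_
    rw [G.inner_eq_sum g f (t := B) fun x hx => Or.inl (hg x hx)]
    exact Finset.sum_eq_zero fun x hx => by rw [h x hx, mul_zero, mul_zero]

theorem coe_lt_spectralBottom_essentialSpectrum_iff {B : ℕ → Finset V} (hB : Monotone B)
    (hB' : ∀ x, ∃ n, x ∈ B n) {l : ℝ} :
    (l : EReal) < spectralBottom G.laplacian.essentialSpectrum ↔
      ∃ n, ∃ μ > l, G.HasLowerBoundOff (B n) μ := by
  rw [G.laplacian_isNonnegSelfAdjoint.coe_lt_spectralBottom_essentialSpectrum_iff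
    G.finSupp_isFormCore G.dense_finSupp (F := fun n => G.supportedIn (B n))
    (fun n => G.finiteDimensional_supportedIn _)]
  · simp only [hasLowerBoundOff_iff, mem_orthogonal_supportedIn]
  · exact fun m n hmn f hf x hx => hf x fun h => hx (hB hmn h)
  · exact fun n f hf => (B n).finite_toSet.subset fun x hx => by
      by_contra h
      exact hx (hf x h)
  · intro f hf
    choose k hk using hB'
    refine ⟨(Set.Finite.toFinset hf).sup k, fun x hx => ?_⟩
    by_contra h
    exact hx (hB (Finset.le_sup ((Set.Finite.mem_toFinset hf).2 h)) (hk x))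

end Lp

end WeightedGraph

/-! ### Positive supersolutions -/

namespace WeightedGraph

section Supersolution

variable {V : Type*} (G : WeightedGraph V)

/-- The right side minus the left is ab‖z - w‖². This is the edgewise form of the ground state
transform, with a, b the values of the supersolution. -/
theorem sub_mul_le_norm_sub_sq (a b : ℝ) (ha : 0 ≤ a) (hb : 0 ≤ b) (z w : ℂ) :
    (a ^ 2 - a * b) * ‖z‖ ^ 2 + (b ^ 2 - b * a) * ‖w‖ ^ 2 ≤ ‖(a : ℂ) * z - (b : ℂ) * w‖ ^ 2 := by
  have h1 : ‖(a : ℂ) * z - (b : ℂ) * w‖ ^ 2 =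
      (a * z.re - b * w.re) ^ 2 + (a * z.im - b * w.im) ^ 2 := by
    rw [← Complex.normSq_eq_norm_sq, Complex.normSq_apply]
    simp
    ring
  rw [h1, ← Complex.normSq_eq_norm_sq, ← Complex.normSq_eq_norm_sq, Complex.normSq_apply,
    Complex.normSq_apply]
  nlinarith [mul_nonneg (mul_nonneg ha hb) (add_nonneg (sq_nonneg (z.re - w.re))
    (sq_nonneg (z.im - w.im)))]

/-- A nonnegative supersolution of `Δ u = μ u`, positive on the support of `f`, bounds the form of
the Laplacian at `f` from below by `μ`. -/
theorem lowerBound_of_supersolution {u : V → ℝ} (hu : ∀ x, 0 ≤ u x) {μ : ℝ} {t : Finset V}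
    {f : V → ℂ} (hf : ∀ x ∉ t, f x = 0) (hpos : ∀ x, f x ≠ 0 → 0 < u x)
    (hsuper : ∀ x, f x ≠ 0 → μ * u x ≤ (G.algLaplacian (fun y => (u y : ℂ)) x).re) :
    μ * ∑ x ∈ t, G.m x * ‖f x‖ ^ 2 ≤
      ∑ x ∈ t, G.m x * ((starRingEnd ℂ) (G.algLaplacian f x) * f x).re := by
  obtain ⟨h, hh⟩ : ∃ h : V → ℂ, h = fun x => f x / u x := ⟨_, rfl⟩
  have hfu : ∀ x, f x = u x * h x := fun x => by
    by_cases h0 : f x = 0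
    · simp [hh, h0]
    · have : (u x : ℂ) ≠ 0 := by exact_mod_cast (hpos x h0).ne'
      rw [hh]
      field_simp
  have hh0 : ∀ x, f x = 0 → h x = 0 := fun x hx => by simp [hh, hx]
  rw [sum_re_algLaplacian_mul_self _ _ hf]
  set s := G.closedNhd t with hs
  have e1 : ∑ x ∈ s, ∑ y ∈ s, G.E x y * ((u x ^ 2 - u x * u y) * ‖h x‖ ^ 2) =
      ∑ x ∈ t, ‖h x‖ ^ 2 * u x * (G.m x * (G.algLaplacian (fun y => (u y : ℂ)) x).re) := by
    classical
    refine (Finset.sum_subset_zero_on_sdiff (G.subset_closedNhd t) (fun x hx => ?_)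
      fun x hx => ?_).symm
    · rw [hh0 x (hf x (Finset.mem_sdiff.1 hx).2)]
      simp
    · have h1 := congrArg Complex.re (G.mul_algLaplacian (fun y => (u y : ℂ)) (s := s)
        fun y hy => G.E_eq_zero_of_notMem_closedNhd hx hy)
      rw [Complex.re_ofReal_mul, Complex.re_sum] at h1
      rw [h1, Finset.mul_sum]
      refine Finset.sum_congr rfl fun y _ => ?_
      rw [← Complex.ofReal_sub, ← Complex.ofReal_mul, Complex.ofReal_re]
      ring
  have e2 : ∑ x ∈ s, ∑ y ∈ s, G.E x y * ((u y ^ 2 - u y * u x) * ‖h y‖ ^ 2) =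
      ∑ x ∈ s, ∑ y ∈ s, G.E x y * ((u x ^ 2 - u x * u y) * ‖h x‖ ^ 2) := by
    rw [Finset.sum_comm]
    refine Finset.sum_congr rfl fun x _ => Finset.sum_congr rfl fun y _ => ?_
    rw [G.E_symm]
  calc μ * ∑ x ∈ t, G.m x * ‖f x‖ ^ 2
      ≤ ∑ x ∈ t, ‖h x‖ ^ 2 * u x * (G.m x * (G.algLaplacian (fun y => (u y : ℂ)) x).re) := by
        rw [Finset.mul_sum]
        refine Finset.sum_le_sum fun x _ => ?_
        by_cases h0 : f x = 0
        · simp [h0, hh0 x h0]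
        · have h1 : ‖f x‖ ^ 2 = u x ^ 2 * ‖h x‖ ^ 2 := by
            rw [hfu, norm_mul, mul_pow, Complex.norm_real, Real.norm_eq_abs, sq_abs]
          have h2 : 0 ≤ ‖h x‖ ^ 2 * u x * G.m x :=
            mul_nonneg (mul_nonneg (sq_nonneg _) (hu x)) (G.m_pos x).le
          rw [h1]
          nlinarith [mul_le_mul_of_nonneg_left (hsuper x h0) h2]
    _ = (1 / 2) * ∑ x ∈ s, ∑ y ∈ s, G.E x y * ((u x ^ 2 - u x * u y) * ‖h x‖ ^ 2 +
          (u y ^ 2 - u y * u x) * ‖h y‖ ^ 2) := by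
        simp only [mul_add, Finset.sum_add_distrib]
        rw [e2, e1]
        ring
    _ ≤ _ := by
        refine mul_le_mul_of_nonneg_left (Finset.sum_le_sum fun x _ => Finset.sum_le_sum fun y _ =>
          mul_le_mul_of_nonneg_left ?_ (G.E_nonneg x y)) (by norm_num)
        rw [hfu x, hfu y]
        exact sub_mul_le_norm_sub_sq _ _ (hu x) (hu y) _ _

end Supersolution

/-! ### Positive solutions of the one-dimensional recursion -/

section Jacobi

/-- On a graph over `ℕ` with edges between consecutive numbers only, a strict lower bound of the
form off `{0, …, n - 1}` gives a solution of `Δ u = μ u` on `[n, ∞)` that vanishes before `n` and is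
positive from `n` on. -/
theorem HasLowerBoundOff.exists_positive_solution {W : WeightedGraph ℕ} {b : ℕ → ℝ}
    (hb : b 0 = 0) (hE : ∀ k, 0 < W.E k (k + 1))
    (hL : ∀ (f : ℕ → ℂ) k, (W.m k : ℂ) * W.algLaplacian f k =
      (W.E k (k + 1) : ℂ) * (f k - f (k + 1)) + (b k : ℂ) * (f k - f (k - 1)))
    {n : ℕ} {μ ν : ℝ} (hν : W.HasLowerBoundOff (Finset.range n) ν) (hμ : μ < ν) :
    ∃ u : ℕ → ℝ, (∀ k < n, u k = 0) ∧ (∀ k ≥ n, 0 < u k) ∧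
      ∀ k ≥ n, W.algLaplacian (fun j => (u j : ℂ)) k = ((μ * u k : ℝ) : ℂ) := by
  -- The pair holds (u(k - 1), u(k)). From n on, the next value is forced by the equation at k,
  -- which is solvable because E(k, k + 1) > 0.
  let p : ℕ → ℝ × ℝ := fun k => Nat.rec (0, if n = 0 then 1 else 0)
    (fun k q => (q.2, if k + 1 < n then 0 else if k + 1 = n then 1 else
      q.2 + (b k * (q.2 - q.1) - μ * W.m k * q.2) / W.E k (k + 1))) k
  let u : ℕ → ℝ := fun k => (p k).2
  have hu0 : u 0 = if n = 0 then 1 else 0 := rfl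
  have hu1 : ∀ k, u (k + 1) = if k + 1 < n then 0 else if k + 1 = n then 1 else
      u k + (b k * (u k - (p k).1) - μ * W.m k * u k) / W.E k (k + 1) := fun k => rfl
  have hzero : ∀ k < n, u k = 0 := by
    rintro (_ | k) hk
    · rw [hu0, if_neg (by omega)]
    · rw [hu1, if_pos hk]
  have hone : u n = 1 := by
    rcases n with _ | n
    · rw [hu0, if_pos rfl]
    · rw [hu1, if_neg (lt_irrefl _), if_pos rfl]
  -- At k = 0 the stored previous value is 0 while u(k - 1) is u(0); the mismatch is harmless
  -- because b 0 = 0.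
  have hb0 : ∀ k, b k * (u k - (p k).1) = b k * (u k - u (k - 1)) := by
    rintro (_ | k)
    · rw [hb, zero_mul, zero_mul]
    · rfl
  have hsol : ∀ k ≥ n, W.algLaplacian (fun j => (u j : ℂ)) k = ((μ * u k : ℝ) : ℂ) := by
    intro k hk
    have hm : (W.m k : ℂ) ≠ 0 := by exact_mod_cast (W.m_pos k).ne'
    refine mul_left_cancel₀ hm ?_
    have h1 := hu1 k
    rw [if_neg (by omega), if_neg (by omega), hb0] at h1
    have h2 : W.E k (k + 1) * (u k - u (k + 1)) + b k * (u k - u (k - 1)) = W.m k * (μ * u k) := by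
      rw [h1]
      have := (hE k).ne'
      field_simp
      ring
    rw [hL]
    exact_mod_cast h2
  refine ⟨u, hzero, fun k hk => ?_, hsol⟩
  induction k, hk using Nat.le_induction with
  | base => rw [hone]; exact one_pos
  | succ k hk ih =>
    -- Truncating u after k changes its Laplacian on [n, k] only at k, so the form at f is μ‖f‖² +
    -- E(k, k + 1) u(k + 1) u(k). It is at least ν‖f‖² > μ‖f‖², which forces u(k + 1) > 0.
    obtain ⟨f, hf⟩ : ∃ f : ℕ → ℂ, f = fun j => if j ≤ k then (u j : ℂ) else 0 := ⟨_, rfl⟩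
    have hfle : ∀ j ≤ k, f j = u j := fun j hj => by rw [hf]; exact if_pos hj
    have h1 := hν (Finset.range (k + 1)) f
      (fun j hj => by rw [hf]; exact if_neg (by simpa using hj))
      (fun j hj => by
        rw [hfle j (by have := Finset.mem_range.1 hj; omega), hzero j (Finset.mem_range.1 hj),
          Complex.ofReal_zero])
    have h2 : ∀ j ∈ Finset.range (k + 1), W.m j * ((starRingEnd ℂ) (W.algLaplacian f j) * f j).re =
        μ * (W.m j * ‖f j‖ ^ 2) + if j = k then W.E k (k + 1) * u (k + 1) * u k else 0 := by
      intro j hj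
      have hjk : j ≤ k := by have := Finset.mem_range.1 hj; omega
      by_cases hjn : j < n
      · rw [if_neg (by omega), hfle j hjk, hzero j hjn]
        simp
      · have h3 : (W.m j : ℂ) * W.algLaplacian f j = ((W.m j * (μ * u j) +
            if j = k then W.E k (k + 1) * u (k + 1) else 0 : ℝ) : ℂ) := by
          have h4 := hsol j (not_lt.1 hjn)
          have h5 := hL (fun j => (u j : ℂ)) j
          rw [h4] at h5
          rw [hL, hfle j hjk, hfle (j - 1) (by omega)]
          by_cases hj' : j = k
          · subst hj'
            rw [if_pos rfl, Complex.ofReal_add, Complex.ofReal_mul, h5, hf]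
            simp only [show ¬ j + 1 ≤ j by omega, if_false]
            push_cast
            ring
          · rw [if_neg hj', hfle (j + 1) (by omega), add_zero, Complex.ofReal_mul, h5]
        have h6 := congrArg (starRingEnd ℂ) h3
        rw [map_mul, Complex.conj_ofReal, Complex.conj_ofReal] at h6
        rw [← Complex.re_ofReal_mul, ← mul_assoc, h6, hfle j hjk, ← Complex.ofReal_mul,
          Complex.ofReal_re, Complex.norm_real, Real.norm_eq_abs, sq_abs]
        by_cases hj' : j = k
        · subst hj'
          simp only [if_true]
          ring
        · simp only [if_neg hj']
          ring
    rw [Finset.sum_congr rfl h2, Finset.sum_add_distrib, ← Finset.mul_sum, Finset.sum_ite_eq',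
      if_pos (by simp)] at h1
    have h3 : 0 < ∑ j ∈ Finset.range (k + 1), W.m j * ‖f j‖ ^ 2 := by
      refine Finset.sum_pos' (fun j _ => mul_nonneg (W.m_pos j).le (sq_nonneg _))
        ⟨k, by simp, mul_pos (W.m_pos k) (pow_pos (norm_pos_iff.2 ?_) 2)⟩
      rw [hfle k le_rfl]
      exact_mod_cast ih.ne'
    have h4 : 0 < W.E k (k + 1) * u (k + 1) * u k := by
      nlinarith [mul_pos (sub_pos.2 hμ) h3]
    exact (mul_pos_iff_of_pos_left (hE k)).1 ((mul_pos_iff_of_pos_right ih).1 h4)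

end Jacobi

/-! ### Weakly spherically symmetric graphs -/

namespace OneDimDecomposition

variable {V : Type*} {G : WeightedGraph V} (D : G.OneDimDecomposition)

open Classical in
/-- The ball `S_0 ∪ … ∪ S_{n-1}`. -/
def ball (n : ℕ) : Finset V := (Finset.range n).biUnion D.S

theorem mem_S_iff {x : V} {n : ℕ} : x ∈ D.S n ↔ D.radius x = n :=
  ⟨D.radius_eq, fun h => h ▸ D.mem_S_radius x⟩

theorem mem_ball {x : V} {n : ℕ} : x ∈ D.ball n ↔ D.radius x < n := by
  simp [ball, mem_S_iff]

theorem radius_le_of_adj {x y : V} (h : 0 < G.E x y) :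
    D.radius x ≤ D.radius y + 1 ∧ D.radius y ≤ D.radius x + 1 := by
  have := abs_le.1 (D.adj _ _ x (D.mem_S_radius x) y (D.mem_S_radius y) h)
  omega

theorem sum_radius (t : Finset ℕ) [DecidableEq V] (c : ℕ → ℝ) :
    ∑ x ∈ t.biUnion D.S, G.m x * c (D.radius x) = ∑ n ∈ t, D.sphereMass n * c n := by
  rw [Finset.sum_biUnion]
  · refine Finset.sum_congr rfl fun n _ => ?_
    rw [sphereMass, Finset.sum_mul]
    exact Finset.sum_congr rfl fun x hx => by rw [D.radius_eq hx]
  · intro m _ n _ hmn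
    refine Finset.disjoint_left.2 fun x hx hx' => hmn ?_
    rw [← D.radius_eq hx, D.radius_eq hx']

theorem degPlus_eq (hD : D.WeaklySphericallySymmetric) (x : V) :
    D.degPlus x = D.radialDegPlus (D.radius x) := (hD x _ (D.radius_point _).symm).1

theorem degMinus_eq (hD : D.WeaklySphericallySymmetric) (x : V) :
    D.degMinus x = D.radialDegMinus (D.radius x) := (hD x _ (D.radius_point _).symm).2

theorem radialDegMinus_zero : D.radialDegMinus 0 = 0 := by
  rw [radialDegMinus, degMinus, radius_point]
  simp [prev]

/-- Edges inside a sphere contribute nothing to a radial function, and the others contribute only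
through deg₊ and deg₋. At radius 0 the inner term carries the factor deg₋ = 0. -/
theorem algLaplacian_comp_radius (hD : D.WeaklySphericallySymmetric) (f : ℕ → ℂ) (x : V) :
    G.algLaplacian (fun y => f (D.radius y)) x =
      (D.radialDegPlus (D.radius x) : ℂ) * (f (D.radius x) - f (D.radius x + 1)) +
      (D.radialDegMinus (D.radius x) : ℂ) * (f (D.radius x) - f (D.radius x - 1)) := by
  classical
  have hm : (G.m x : ℂ) ≠ 0 := by exact_mod_cast (G.m_pos x).ne'
  refine mul_left_cancel₀ hm ?_
  obtain ⟨n, hn⟩ : ∃ n, D.radius x = n := ⟨_, rfl⟩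
  have hprev : ∀ y ∈ D.prev n, D.radius y + 1 = n := by
    intro y hy
    rcases n with _ | n
    · simp [prev] at hy
    · rw [D.radius_eq hy]
  have hd1 : Disjoint (D.S n) (D.S (n + 1)) := Finset.disjoint_left.2 fun y h1 h2 => by
    have := D.radius_eq h1
    have := D.radius_eq h2
    omega
  have hd2 : Disjoint (D.prev n) (D.S n ∪ D.S (n + 1)) := Finset.disjoint_left.2 fun y h1 h2 => by
    have := hprev y h1
    rcases Finset.mem_union.1 h2 with h | h <;> have := D.radius_eq h <;> omega
  rw [G.mul_algLaplacian (s := D.prev n ∪ (D.S n ∪ D.S (n + 1))), Finset.sum_union hd2,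
    Finset.sum_union hd1, hn]
  · have h1 : ∑ y ∈ D.prev n, (G.E x y : ℂ) * (f n - f (D.radius y)) =
        ((G.m x * D.degMinus x : ℝ) : ℂ) * (f n - f (n - 1)) := by
      rw [degMinus, mul_div_cancel₀ _ (G.m_pos x).ne', hn, Complex.ofReal_sum, Finset.sum_mul]
      exact Finset.sum_congr rfl fun y hy => by rw [← hprev y hy, Nat.add_sub_cancel]
    have h2 : ∑ y ∈ D.S n, (G.E x y : ℂ) * (f n - f (D.radius y)) = 0 :=
      Finset.sum_eq_zero fun y hy => by rw [D.radius_eq hy, sub_self, mul_zero]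
    have h3 : ∑ y ∈ D.S (n + 1), (G.E x y : ℂ) * (f n - f (D.radius y)) =
        ((G.m x * D.degPlus x : ℝ) : ℂ) * (f n - f (n + 1)) := by
      rw [degPlus, mul_div_cancel₀ _ (G.m_pos x).ne', hn, Complex.ofReal_sum, Finset.sum_mul]
      exact Finset.sum_congr rfl fun y hy => by rw [D.radius_eq hy]
    rw [h1, h2, h3, D.degPlus_eq hD, D.degMinus_eq hD, hn]
    push_cast
    ring
  · intro y hy
    by_contra hE
    have h := D.radius_le_of_adj (lt_of_le_of_ne (G.E_nonneg x y) (Ne.symm hE))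
    refine hy ?_
    simp only [Finset.mem_union, mem_S_iff]
    rcases n with _ | n
    · right; omega
    · simp only [prev, mem_S_iff]
      omega

theorem mul_algLaplacian_radialGraph (hD : D.WeaklySphericallySymmetric) (f : ℕ → ℂ) (n : ℕ) :
    ((D.radialGraph hD).m n : ℂ) * (D.radialGraph hD).algLaplacian f n =
      ((D.radialGraph hD).E n (n + 1) : ℂ) * (f n - f (n + 1)) +
      ((D.sphereMass n * D.radialDegMinus n : ℝ) : ℂ) * (f n - f (n - 1)) := by
  have hE : ∀ k, (D.radialGraph hD).E n k = D.radialE n k := fun _ => rfl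
  rcases n with _ | n
  · rw [(D.radialGraph hD).mul_algLaplacian f (s := {1}), Finset.sum_singleton,
      radialDegMinus_zero]
    · simp
    · intro k hk
      rw [hE, radialE, if_neg (by simpa using hk), if_neg (by omega)]
  · rw [(D.radialGraph hD).mul_algLaplacian f (s := {n + 2, n}), Finset.sum_pair (by omega)]
    · have h : (D.radialGraph hD).E (n + 1) n =
          D.sphereMass (n + 1) * D.radialDegMinus (n + 1) := by
        rw [hE, radialE, if_neg (by omega), if_pos rfl]
      rw [h]
      rfl
    · intro k hk
      simp only [Finset.mem_insert, Finset.mem_singleton, not_or] at hk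
      rw [hE, radialE, if_neg hk.1, if_neg (by omega)]

theorem radialE_succ (n : ℕ) : D.radialE n (n + 1) = D.sphereMass n * D.radialDegPlus n :=
  if_pos rfl

theorem algLaplacian_comp_radius_eq (hD : D.WeaklySphericallySymmetric) (f : ℕ → ℂ) (x : V) :
    G.algLaplacian (fun y => f (D.radius y)) x =
      (D.radialGraph hD).algLaplacian f (D.radius x) := by
  have hm : (D.sphereMass (D.radius x) : ℂ) ≠ 0 := by
    exact_mod_cast (D.sphereMass_pos _).ne'
  refine mul_left_cancel₀ hm ?_
  refine Eq.trans ?_ (D.mul_algLaplacian_radialGraph hD f (D.radius x)).symm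
  rw [show (D.radialGraph hD).E (D.radius x) (D.radius x + 1) = _ from D.radialE_succ _,
    D.algLaplacian_comp_radius hD]
  push_cast
  ring

/-- If deg₊(n) vanished, no edge would leave the finite ball of radius n, and the component of a
point of S_n would be finite. -/
theorem radialE_succ_pos (hG : G.InfiniteComponents) (hD : D.WeaklySphericallySymmetric) (n : ℕ) :
    0 < D.radialE n (n + 1) := by
  rw [radialE_succ]
  refine mul_pos (D.sphereMass_pos n) (lt_of_le_of_ne (D.degPlus_nonneg _) fun h0 => ?_)
  have hno : ∀ x y, D.radius x = n → D.radius y = n + 1 → ¬ 0 < G.E x y := by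
    intro x y hx hy hxy
    have h1 : D.degPlus x = 0 := by rw [D.degPlus_eq hD, hx, ← h0]
    rw [degPlus, div_eq_zero_iff, or_iff_left (G.m_pos x).ne', hx,
      Finset.sum_eq_zero_iff_of_nonneg fun _ _ => G.E_nonneg _ _] at h1
    exact hxy.ne' (h1 y (D.mem_S_iff.2 hy))
  refine hG (D.point n) ((D.ball (n + 1)).finite_toSet.subset fun y hy => ?_)
  rw [Finset.mem_coe, mem_ball]
  change Relation.ReflTransGen _ _ _ at hy
  induction hy with
  | refl => rw [radius_point]; omega
  | @tail b c _ hbc ih =>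
    by_contra hc
    have h := D.radius_le_of_adj hbc
    exact hno b c (by omega) (by omega) hbc

/-- Test the bound on radial functions: both sums collapse to sums over ℕ with weights m(S_k). -/
theorem hasLowerBoundOff_radialGraph (hD : D.WeaklySphericallySymmetric) {n : ℕ} {μ : ℝ}
    (h : G.HasLowerBoundOff (D.ball n) μ) :
    (D.radialGraph hD).HasLowerBoundOff (Finset.range n) μ := by
  classical
  intro t f ht hf
  have h1 := h (t.biUnion D.S) (fun x => f (D.radius x))
    (fun x hx => ht _ fun h => hx (Finset.mem_biUnion.2 ⟨_, h, D.mem_S_radius x⟩))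
    (fun x hx => hf _ (Finset.mem_range.2 (D.mem_ball.1 hx)))
  simp only [D.algLaplacian_comp_radius_eq hD] at h1
  rw [D.sum_radius t fun k => ‖f k‖ ^ 2, D.sum_radius t fun k =>
    ((starRingEnd ℂ) ((D.radialGraph hD).algLaplacian f k) * f k).re] at h1
  exact h1

/-- The one-dimensional positive solution, composed with the radius, satisfies the eigenvalue
equation on the graph outside the ball. It thus serves as the supersolution for arbitrary, not
merely radial, test functions vanishing on the ball. -/
theorem hasLowerBoundOff_of_radialGraph (hG : G.InfiniteComponents)
    (hD : D.WeaklySphericallySymmetric) {n : ℕ} {μ ν : ℝ}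
    (h : (D.radialGraph hD).HasLowerBoundOff (Finset.range n) ν) (hμ : μ < ν) :
    G.HasLowerBoundOff (D.ball n) μ := by
  obtain ⟨u, hu0, hu1, hu2⟩ := h.exists_positive_solution
    (by rw [radialDegMinus_zero, mul_zero]) (D.radialE_succ_pos hG hD)
    (D.mul_algLaplacian_radialGraph hD) hμ
  intro t f ht hf
  have hr : ∀ x, f x ≠ 0 → n ≤ D.radius x := fun x hx =>
    not_lt.1 fun h => hx (hf x (D.mem_ball.2 h))
  refine G.lowerBound_of_supersolution (u := fun x => u (D.radius x)) (fun x => ?_) ht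
    (fun x hx => hu1 _ (hr x hx)) fun x hx => ?_
  · rcases lt_or_ge (D.radius x) n with h | h
    · exact (hu0 _ h).ge
    · exact (hu1 _ h).le
  · rw [D.algLaplacian_comp_radius_eq hD (fun k => (u k : ℂ)), hu2 _ (hr x hx), Complex.ofReal_re]

theorem exists_hasLowerBoundOff_iff (hG : G.InfiniteComponents)
    (hD : D.WeaklySphericallySymmetric) (n : ℕ) (l : ℝ) :
    (∃ μ > l, G.HasLowerBoundOff (D.ball n) μ) ↔
      ∃ μ > l, (D.radialGraph hD).HasLowerBoundOff (Finset.range n) μ := by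
  constructor
  · rintro ⟨μ, hμ, h⟩
    exact ⟨μ, hμ, D.hasLowerBoundOff_radialGraph hD h⟩
  · rintro ⟨ν, hν, h⟩
    obtain ⟨μ, hμ1, hμ2⟩ := exists_between hν
    exact ⟨μ, hμ1, D.hasLowerBoundOff_of_radialGraph hG hD h hμ2⟩

end OneDimDecomposition

end WeightedGraph

/-! ### Equality of the spectral bottoms -/

theorem EReal.eq_of_forall_coe_lt_iff {a b : EReal}
    (h : ∀ l : ℝ, (l : EReal) < a ↔ (l : EReal) < b) :
    a = b := by
  refine le_antisymm ?_ ?_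
  · refine le_of_forall_lt fun c hc => ?_
    obtain ⟨l, h1, h2⟩ := EReal.lt_iff_exists_real_btwn.1 hc
    exact h1.trans ((h l).1 h2)
  · refine le_of_forall_lt fun c hc => ?_
    obtain ⟨l, h1, h2⟩ := EReal.lt_iff_exists_real_btwn.1 hc
    exact h1.trans ((h l).2 h2)

end

theorem mainTheorem6 {V : Type*} [Countable V] [MeasurableSpace V] [DiscreteMeasurableSpace V]
    (G : WeightedGraph V) (hG : G.InfiniteComponents)
    (D : G.OneDimDecomposition) (hD : D.WeaklySphericallySymmetric)
    (hm : G.measure Set.univ = ⊤) :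
    spectralBottom G.laplacian.spectrum =
        spectralBottom (D.radialGraph hD).laplacian.spectrum ∧
      spectralBottom G.laplacian.essentialSpectrum =
        spectralBottom (D.radialGraph hD).laplacian.essentialSpectrum := by
  refine ⟨EReal.eq_of_forall_coe_lt_iff fun l => ?_, EReal.eq_of_forall_coe_lt_iff fun l => ?_⟩
  · rw [G.coe_lt_spectralBottom_spectrum_iff,
      (D.radialGraph hD).coe_lt_spectralBottom_spectrum_iff]
    -- For n = 0 the excluded sets are empty, so these are bounds on all finitely supported
    -- functions.
    have h := D.exists_hasLowerBoundOff_iff hG hD 0 l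
    rwa [show D.ball 0 = ∅ by simp [WeightedGraph.OneDimDecomposition.ball],
      Finset.range_zero] at h
  · have hmono : Monotone D.ball := fun m n hmn x hx =>
      D.mem_ball.2 ((D.mem_ball.1 hx).trans_le hmn)
    rw [G.coe_lt_spectralBottom_essentialSpectrum_iff hmono
        fun x => ⟨_, D.mem_ball.2 (Nat.lt_succ_self _)⟩,
      (D.radialGraph hD).coe_lt_spectralBottom_essentialSpectrum_iff Finset.range_mono
        fun x => ⟨_, Finset.self_mem_range_succ x⟩]
    exact exists_congr fun n => D.exists_hasLowerBoundOff_iff hG hD n l
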